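/- Let $\bm a_1,\dots,\bm a_m$ be independent standard Gaussian vectors in $\mathbb R^n$, let $\bm x\in\mathbb R^n\setminus\{0\}$, $y_k=|\bm a_k^\top\bm x|^2$, and $$f(\bm z)=\frac1{2m}\sum_{k=1}^m\big((\bm a_k^\top\bm z)^2-(\bm a_k^\top\bm x)^2\big)^2\,h\!\left(\frac{|\bm a_k^\top\bm z|^2}{\|\bm z\|^2}\right)h\!\left(\frac{m|\bm a_k^\top\bm x|^2}{\|\bm y\|_1}\right),$$ where the activation function $h$ satisfies $h=1$ on $[0,\beta]$, $0\le h\le1$ on $(\beta,\gamma)$, $h=0$ on $[\gamma,\infty)$, and $h',h''$ exist with $|h'|,|h''|\le M$; here $\gamma=\kappa\beta$ with a fixed constant $\kappa>1$, and $M$ is a fixed constant. Let $0<\delta\le\frac1{100}$ be fixed and put $$\mathcal R_{2a}=\Big\{\bm z:\ \tfrac13-\delta<\tfrac{\|\bm z\|^2}{\|\bm x\|^2}<\tfrac{99}{100}\ \text{ and }\ \min\{\|\bm z-\bm x\|,\|\bm z+\bm x\|\}>\tfrac15\|\bm x\|\Big\}.$$ There is $\beta_0>1$, depending only on $\delta,\kappa,M$,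 such that for every $\beta\ge\beta_0$ there are constants $C,c>0$, depending only on $\delta,\kappa,M,\beta$, with the following property. For all $h$ as above, all $n,m$ with $m\ge Cn$ and all $\bm x\ne0$, with probability at least $1-e^{-cm}$ the following hold simultaneously: (i) every critical point $\bm z\in\mathcal R_{2a}$ of $f$ lies in the subregion $$\tfrac13-\delta<\tfrac{\|\bm z\|^2}{\|\bm x\|^2}<\tfrac13+\delta,\qquad |\bm z^\top\bm x|<\delta\|\bm x\|^2;$$ (ii) for all $\bm z$ in this subregion, $\bm x^\top\nabla^2f(\bm z)\bm x\le-3\|\bm x\|^4$ and $\bm z^\top\nabla^2f(\bm z)\bm z\ge\|\bm x\|^4$; (iii) consequently, every critical point of $f$ in $\mathcal R_{2a}$ is a ridable saddle: it is neither a local minimizer nor a local maximizer, and the Hessian has a direction of strictly negative and a direction of strictly positive curvature there. -/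

import Mathlib

open MeasureTheory ProbabilityTheory

noncomputable section

/-- The class of activation functions with parameters `β < γ` whose first two derivatives are
bounded by `M`. Only the values of `h` on `[0, ∞)` matter. Since `h = 1` on `[0, β]`, the one-sided
derivatives at `0` exist and vanish, so the derivatives are only considered on `(0, ∞)`. -/
structure IsActivation (h : ℝ → ℝ) (β γ M : ℝ) : Prop where
  eq_one : ∀ u : ℝ, 0 ≤ u → u ≤ β → h u = 1
  mem_Icc : ∀ u : ℝ, β < u → u < γ → h u ∈ Set.Icc (0 : ℝ) 1
  eq_zero : ∀ u : ℝ, γ ≤ u → h u = 0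
  differentiableAt : ∀ u : ℝ, 0 < u → DifferentiableAt ℝ h u
  differentiableAt_deriv : ∀ u : ℝ, 0 < u → DifferentiableAt ℝ (deriv h) u
  abs_deriv_le : ∀ u : ℝ, 0 < u → |deriv h u| ≤ M
  abs_deriv_deriv_le : ∀ u : ℝ, 0 < u → |deriv (deriv h) u| ≤ M

/-- The phaseless measurements `y k = |aₖᵀ x|²`. -/
def measurement {n m : ℕ} (a : Fin m → EuclideanSpace ℝ (Fin n)) (x : EuclideanSpace ℝ (Fin n))
    (k : Fin m) : ℝ :=
  |inner ℝ (a k) x| ^ 2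

/-- The loss function
`f(z) = (1 / 2m) ∑ₖ ((aₖᵀ z)² - (aₖᵀ x)²)² h(|aₖᵀ z|² / ‖z‖²) h(m |aₖᵀ x|² / ‖y‖₁)`. -/
def loss {n m : ℕ} (h : ℝ → ℝ) (a : Fin m → EuclideanSpace ℝ (Fin n))
    (x z : EuclideanSpace ℝ (Fin n)) : ℝ :=
  1 / (2 * (m : ℝ)) * ∑ k : Fin m,
    ((inner ℝ (a k) z) ^ 2 - (inner ℝ (a k) x) ^ 2) ^ 2
      * h (|inner ℝ (a k) z| ^ 2 / ‖z‖ ^ 2)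
      * h ((m : ℝ) * |inner ℝ (a k) x| ^ 2 / ∑ j : Fin m, |measurement a x j|)

/-- The distance up to a global sign, `min {‖z - x‖, ‖z + x‖}`. -/
def signDist {n : ℕ} (z x : EuclideanSpace ℝ (Fin n)) : ℝ :=
  min ‖z - x‖ ‖z + x‖

/-- The region `1/3 - δ < ‖z‖²/‖x‖² < 99/100`, `dist(z, x) > ‖x‖/5`. -/
def regionTwoA {n : ℕ} (δ : ℝ) (x : EuclideanSpace ℝ (Fin n)) :
    Set (EuclideanSpace ℝ (Fin n)) :=
  {z | 1 / 3 - δ < ‖z‖ ^ 2 / ‖x‖ ^ 2 ∧ ‖z‖ ^ 2 / ‖x‖ ^ 2 < 99 / 100 ∧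
    1 / 5 * ‖x‖ < signDist z x}

/-- The subregion `1/3 - δ < ‖z‖²/‖x‖² < 1/3 + δ`, `|zᵀ x| < δ ‖x‖²`. -/
def subregionTwoA {n : ℕ} (δ : ℝ) (x : EuclideanSpace ℝ (Fin n)) :
    Set (EuclideanSpace ℝ (Fin n)) :=
  {z | 1 / 3 - δ < ‖z‖ ^ 2 / ‖x‖ ^ 2 ∧ ‖z‖ ^ 2 / ‖x‖ ^ 2 < 1 / 3 + δ ∧
    |inner ℝ z x| < δ * ‖x‖ ^ 2}

/-- The quadratic form `vᵀ ∇²f(z) v` of the Hessian (the Jacobian of the gradient) of `f`. -/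
def hessianForm {n : ℕ} (f : EuclideanSpace ℝ (Fin n) → ℝ) (z v : EuclideanSpace ℝ (Fin n)) : ℝ :=
  inner ℝ v (fderiv ℝ (gradient f) z v)

/-- A ridable saddle point: a critical point that is neither a local minimizer nor a local
maximizer, at which the Hessian has a direction of strictly negative curvature and one of strictly
positive curvature. -/
structure IsRidableSaddle {n : ℕ} (f : EuclideanSpace ℝ (Fin n) → ℝ)
    (z : EuclideanSpace ℝ (Fin n)) : Prop where
  critical : HasGradientAt f 0 z
  not_isLocalMin : ¬ IsLocalMin f z
  not_isLocalMax : ¬ IsLocalMax f z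
  exists_neg : ∃ v, hessianForm f z v < 0
  exists_pos : ∃ v, 0 < hessianForm f z v

end

/-! Without the cutoffs the expectation of `f` is explicit. Its gradient pairs with `z` to `2(3‖z‖⁴
- ‖z‖²‖x‖² - 2⟨z,x⟩²)` and with `x` to `6⟨z,x⟩(‖z‖² - ‖x‖²)`. At a critical point with `‖z‖² <
(99/100)‖x‖²` the second forces `⟨z,x⟩ ≈ 0`, and then the first forces `‖z‖² ≈ ‖x‖²/3`. There the
Hessian forms at `x` and `z` are about `-4‖x‖⁴` and `(4/3)‖x‖⁴`. All these inequalities have slack,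
so it suffices that the four quantities for `f` are uniformly within a small multiple of `‖x‖⁴` of
these values (`IsNearPopulationLoss`, `IsNearPopulationLoss.landscape`).

Writing `z = ‖z‖ v` and `x = ‖x‖ u`, the main terms are combinations of the fourth moments of `s =
⟨a,v⟩` and `t = ⟨a,u⟩`, weighted by cutoffs. They are compared with moments of `s`, `t` clipped at
`R = √(β/2)`, which do not involve `h`, so the probability constants do not depend on `h`. Clipped
monomials are bounded and Lipschitz, so Hoeffding's bound on a net of the sphere gives a law of
large numbers uniform in `v` (`highProb_uniform_lln`, `exists_highProb_truncated_moments`).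

Clipping biases the moments by `O(R⁻²)`, and a twelfth moment bounds the fraction of samples with
`|s| > R` by `O(R⁻¹²) = O(β⁻⁶)`. Only on such samples do derivatives of `h` contribute, by at most
`O(β⁴)` each, and in the radial direction not at all. The total error is `O(1/β)`
(`truncation_error_le`), which fixes `β₀`. -/

/-! ### Nets of the unit sphere. -/

/-- A `ρ`-separated finite subset of the unit sphere has at most `(1 + 2 / ρ) ^ dim` points. -/
lemma card_le_of_separated_sphere {n : ℕ} {ρ : ℝ} (hρ : 0 < ρ)
    (s : Finset (EuclideanSpace ℝ (Fin n))) (hs : ∀ v ∈ s, ‖v‖ = 1)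
    (h : ∀ v ∈ s, ∀ w ∈ s, v ≠ w → ρ ≤ ‖v - w‖) : (s.card : ℝ) ≤ (1 + 2 / ρ) ^ n := by
  let E := EuclideanSpace ℝ (Fin n)
  let μ : Measure E := volume
  have hr : 0 < ρ / 2 := by positivity
  have hR : 0 < 1 + ρ / 2 := by positivity
  have D : Set.Pairwise (s : Set E)
      (Function.onFun Disjoint fun c => Metric.ball (c : E) (ρ / 2)) := by
    rintro c hc d hd hcd
    apply Metric.ball_disjoint_ball
    rw [dist_eq_norm]
    linarith [h c hc d hd hcd]
  have A_subset : (⋃ c ∈ s, Metric.ball (c : E) (ρ / 2)) ⊆ Metric.ball (0 : E) (1 + ρ / 2) := by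
    refine Set.iUnion₂_subset fun x hx => Metric.ball_subset_ball' ?_
    rw [dist_zero_right, hs x hx, add_comm]
  have I : (s.card : ENNReal) * ENNReal.ofReal ((ρ / 2) ^ n) * μ (Metric.ball 0 1) ≤
      ENNReal.ofReal ((1 + ρ / 2) ^ n) * μ (Metric.ball 0 1) :=
    calc
      _ = μ (⋃ c ∈ s, Metric.ball (c : E) (ρ / 2)) := by
        rw [measure_biUnion_finset D fun c _ => measurableSet_ball]
        simp only [μ.addHaar_ball_of_pos _ hr, E, finrank_euclideanSpace, Fintype.card_fin]
        simp only [Finset.sum_const, nsmul_eq_mul, mul_assoc]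
      _ ≤ μ (Metric.ball (0 : E) (1 + ρ / 2)) := measure_mono A_subset
      _ = _ := by
        simp only [μ.addHaar_ball_of_pos _ hR, E, finrank_euclideanSpace, Fintype.card_fin]
  have J := (ENNReal.mul_le_mul_iff_left
    (Metric.measure_ball_pos μ _ zero_lt_one).ne' measure_ball_lt_top.ne).1 I
  have K := ENNReal.toReal_le_of_le_ofReal (pow_nonneg hR.le _) J
  rw [ENNReal.toReal_mul, ENNReal.toReal_ofReal (by positivity)] at K
  have e : (1 + 2 / ρ) = (1 + ρ / 2) / (ρ / 2) := by field_simp; ring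
  rw [e, div_pow, le_div_iff₀ (by positivity)]
  simpa using K

/-- The unit sphere has a `ρ`-net with at most `(1 + 2 / ρ) ^ dim` points. -/
lemma exists_net_sphere (n : ℕ) {ρ : ℝ} (hρ : 0 < ρ) :
    ∃ s : Finset (EuclideanSpace ℝ (Fin n)), (s.card : ℝ) ≤ (1 + 2 / ρ) ^ n ∧
      (∀ v ∈ s, ‖v‖ = 1) ∧ ∀ v : EuclideanSpace ℝ (Fin n), ‖v‖ = 1 → ∃ w ∈ s, ‖v - w‖ ≤ ρ := by
  classical
  -- A separated set of maximal cardinality is a net: a point farther than `ρ` from all its members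
  -- could be added.
  let S : Set ℕ := {k | ∃ s : Finset (EuclideanSpace ℝ (Fin n)), (∀ v ∈ s, ‖v‖ = 1) ∧
    (∀ v ∈ s, ∀ w ∈ s, v ≠ w → ρ ≤ ‖v - w‖) ∧ s.card = k}
  have hne : S.Nonempty := ⟨0, ∅, by simp⟩
  have hbdd : BddAbove S := by
    refine ⟨⌈(1 + 2 / ρ) ^ n⌉₊, ?_⟩
    rintro k ⟨s, hs, h, rfl⟩
    exact_mod_cast (card_le_of_separated_sphere hρ s hs h).trans (Nat.le_ceil _)
  obtain ⟨s, hs, h, hk⟩ := Nat.sSup_mem hne hbdd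
  refine ⟨s, card_le_of_separated_sphere hρ s hs h, hs, fun v hv => ?_⟩
  by_contra! hcon
  have hvs : v ∉ s := fun hmem => by
    have := hcon v hmem
    simp at this
    linarith
  have hmem : s.card + 1 ∈ S := by
    refine ⟨insert v s, ?_, ?_, Finset.card_insert_of_notMem hvs⟩
    · intro w hw
      rcases Finset.mem_insert.1 hw with rfl | hw
      · exact hv
      · exact hs w hw
    · intro w hw w' hw' hne'
      rcases Finset.mem_insert.1 hw with rfl | hw <;> rcases Finset.mem_insert.1 hw' with rfl | hw'
      · exact absurd rfl hne'
      · exact (hcon w' hw').le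
      · rw [norm_sub_rev]; exact (hcon w (by assumption)).le
      · exact h w hw w' hw' hne'
  have := le_csSup hbdd hmem
  omega

/-! ### Empirical means and their concentration. -/

/-- The empirical mean of finitely many real numbers. -/
noncomputable def empMean {m : ℕ} (f : Fin m → ℝ) : ℝ := 1 / (m : ℝ) * ∑ k, f k

lemma empMean_mono {m : ℕ} {f g : Fin m → ℝ} (h : ∀ k, f k ≤ g k) : empMean f ≤ empMean g :=
  mul_le_mul_of_nonneg_left (Finset.sum_le_sum fun k _ => h k) (by positivity)

lemma empMean_add {m : ℕ} (f g : Fin m → ℝ) :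
    empMean (fun k => f k + g k) = empMean f + empMean g := by
  simp only [empMean, Finset.sum_add_distrib, mul_add]

lemma empMean_sub {m : ℕ} (f g : Fin m → ℝ) :
    empMean (fun k => f k - g k) = empMean f - empMean g := by
  simp only [empMean, Finset.sum_sub_distrib, mul_sub]

lemma empMean_const_mul {m : ℕ} (c : ℝ) (f : Fin m → ℝ) :
    empMean (fun k => c * f k) = c * empMean f := by
  simp only [empMean, ← Finset.mul_sum]; ring

lemma abs_empMean_le {m : ℕ} {f g : Fin m → ℝ} (h : ∀ k, |f k| ≤ g k) :
    |empMean f| ≤ empMean g := by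
  rw [empMean, abs_mul, abs_of_nonneg (by positivity : (0 : ℝ) ≤ 1 / m)]
  exact mul_le_mul_of_nonneg_left ((Finset.abs_sum_le_sum_abs _ _).trans
    (Finset.sum_le_sum fun k _ => h k)) (by positivity)

lemma empMean_nonneg {m : ℕ} {f : Fin m → ℝ} (h : ∀ k, 0 ≤ f k) : 0 ≤ empMean f :=
  mul_nonneg (by positivity) (Finset.sum_nonneg fun k _ => h k)

/-- The law of `m` independent standard Gaussian vectors in `ℝⁿ`. -/
noncomputable abbrev gaussianSample (n m : ℕ) : Measure (Fin m → EuclideanSpace ℝ (Fin n)) :=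
  Measure.pi fun _ => stdGaussian (EuclideanSpace ℝ (Fin n))

/-- Chernoff's bound for the empirical mean of a function of independent Gaussian vectors. -/
lemma gaussianSample_empMean_gt_le {n m : ℕ} {g : EuclideanSpace ℝ (Fin n) → ℝ} {b K : ℝ}
    (hint : Integrable (fun x => Real.exp (g x)) (stdGaussian (EuclideanSpace ℝ (Fin n))))
    (hb : ∫ x, Real.exp (g x) ∂stdGaussian (EuclideanSpace ℝ (Fin n)) ≤ Real.exp b) :
    gaussianSample n m {a | K < empMean fun k => g (a k)} ≤
      ENNReal.ofReal (Real.exp (-((K - b) * m))) := by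
  rcases Nat.eq_zero_or_pos m with rfl | hm
  · simpa using prob_le_one
  have hm' : (0 : ℝ) < m := by exact_mod_cast hm
  have hI : Integrable (fun a : Fin m → EuclideanSpace ℝ (Fin n) => ∏ k, Real.exp (g (a k)))
      (gaussianSample n m) := Integrable.fintype_prod fun _ => hint
  have hM := mul_meas_ge_le_integral_of_nonneg (μ := gaussianSample n m)
    (Filter.Eventually.of_forall fun a => Finset.prod_nonneg fun k _ => (Real.exp_pos _).le) hI
    (Real.exp (K * m))
  rw [integral_fintype_prod_eq_pow (f := fun x : EuclideanSpace ℝ (Fin n) => Real.exp (g x)),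
    Fintype.card_fin] at hM
  have h1 : (gaussianSample n m).real
      {a | Real.exp (K * m) ≤ ∏ k, Real.exp (g (a k))} ≤ Real.exp (-((K - b) * m)) := by
    have h2 : (∫ x, Real.exp (g x) ∂stdGaussian (EuclideanSpace ℝ (Fin n))) ^ m ≤
        Real.exp (b * m) := by
      rw [mul_comm, Real.exp_nat_mul]
      exact pow_le_pow_left₀ (integral_nonneg fun x => (Real.exp_pos _).le) hb _
    have h3 := hM.trans h2
    rw [← le_div_iff₀' (Real.exp_pos _), ← Real.exp_sub] at h3
    rwa [show -((K - b) * m) = b * m - K * m by ring]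
  refine le_trans (measure_mono fun a ha => ?_) ((ENNReal.le_ofReal_iff_toReal_le
    (measure_ne_top _ _) (Real.exp_pos _).le).2 h1)
  simp only [Set.mem_ofPred_eq, empMean] at ha ⊢
  rw [← Real.exp_sum, Real.exp_le_exp]
  rw [one_div, lt_inv_mul_iff₀ hm'] at ha
  linarith

/-- Hoeffding's bound for the empirical mean of a bounded function of independent Gaussian
vectors. -/
lemma gaussianSample_empMean_sub_integral_gt_le {n m : ℕ} {g : EuclideanSpace ℝ (Fin n) → ℝ}
    (hg : Measurable g) {B ε : ℝ} (hB : 0 < B) (hε : 0 < ε) (hgB : ∀ x, |g x| ≤ B) :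
    gaussianSample n m {a | ε < (empMean fun k => g (a k)) -
        ∫ x, g x ∂stdGaussian (EuclideanSpace ℝ (Fin n))} ≤
      ENNReal.ofReal (Real.exp (-(ε ^ 2 / (2 * B ^ 2) * m))) := by
  rcases Nat.eq_zero_or_pos m with rfl | hm
  · simpa using prob_le_one
  have hm' : (m : ℝ) ≠ 0 := by exact_mod_cast hm.ne'
  set e := ∫ x, g x ∂stdGaussian (EuclideanSpace ℝ (Fin n)) with he
  have hsub := hasSubgaussianMGF_of_mem_Icc (μ := stdGaussian (EuclideanSpace ℝ (Fin n)))
    hg.aemeasurable (a := -B) (b := B) (Filter.Eventually.of_forall fun x => abs_le.1 (hgB x))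
  rw [← he] at hsub
  have hc : (((‖B - -B‖₊ / 2) ^ 2 : NNReal) : ℝ) = B ^ 2 := by
    push_cast
    rw [Real.norm_eq_abs, abs_of_pos (by linarith)]
    ring
  -- The parameter `ε / B²` maximizes the Chernoff exponent `λ ε - λ² B² / 2`.
  have hmgf := hsub.mgf_le (ε / B ^ 2)
  rw [hc, mgf] at hmgf
  have key := gaussianSample_empMean_gt_le (m := m) (K := ε ^ 2 / B ^ 2)
    (hsub.integrable_exp_mul (ε / B ^ 2)) hmgf
  refine (measure_mono fun a ha => ?_).trans (key.trans (le_of_eq ?_))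
  · simp only [Set.mem_ofPred_eq] at ha ⊢
    rw [empMean_const_mul, empMean_sub]
    have h1 : empMean (fun _ : Fin m => e) = e := by
      simp only [empMean, Finset.sum_const, Finset.card_univ, Fintype.card_fin, nsmul_eq_mul]
      field_simp
    rw [h1, show ε ^ 2 / B ^ 2 = ε / B ^ 2 * ε by ring]
    exact mul_lt_mul_of_pos_left ha (by positivity)
  · congr 3
    field_simp
    ring

/-! ### Events of overwhelming probability. -/

/-- A property of a unit vector and a sample of `m` standard Gaussian vectors in `ℝⁿ` that holds
with probability at least `1 - exp (-c m)` as soon as `m ≥ C n`, where `C, c > 0` are constants. -/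
def HighProb (Q : ∀ {n m : ℕ}, EuclideanSpace ℝ (Fin n) →
    (Fin m → EuclideanSpace ℝ (Fin n)) → Prop) : Prop :=
  ∃ C c : ℝ, 0 < C ∧ 0 < c ∧ ∀ n m : ℕ, C * (n : ℝ) ≤ (m : ℝ) →
    ∀ u : EuclideanSpace ℝ (Fin n), ‖u‖ = 1 →
      gaussianSample n m {a | ¬ Q u a} ≤ ENNReal.ofReal (Real.exp (-(c * m)))

/-- With `n ≥ 1`, the condition `m ≥ C n` yields `m ≥ C`, so fixed factors in front of an
exponential can be absorbed by enlarging `C`. -/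
lemma one_le_dim_of_norm_eq_one {n : ℕ} {u : EuclideanSpace ℝ (Fin n)} (hu : ‖u‖ = 1) :
    (1 : ℝ) ≤ n := by
  rcases Nat.eq_zero_or_pos n with rfl | hn
  · simp [Subsingleton.elim u 0] at hu
  · exact_mod_cast hn

lemma HighProb.mono {Q Q' : ∀ {n m : ℕ}, EuclideanSpace ℝ (Fin n) →
    (Fin m → EuclideanSpace ℝ (Fin n)) → Prop} (hQ : HighProb Q)
    (h : ∀ {n m : ℕ} (u : EuclideanSpace ℝ (Fin n)) (a : Fin m → EuclideanSpace ℝ (Fin n)),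
      ‖u‖ = 1 → Q u a → Q' u a) : HighProb Q' := by
  obtain ⟨C, c, hC, hc, H⟩ := hQ
  exact ⟨C, c, hC, hc, fun n m hm u hu =>
    (measure_mono fun a (ha : ¬ Q' u a) (hq : Q u a) => ha (h u a hu hq)).trans (H n m hm u hu)⟩

lemma HighProb.and {Q Q' : ∀ {n m : ℕ}, EuclideanSpace ℝ (Fin n) →
    (Fin m → EuclideanSpace ℝ (Fin n)) → Prop} (hQ : HighProb Q) (hQ' : HighProb Q') :
    HighProb fun u a => Q u a ∧ Q' u a := by
  obtain ⟨C, c, hC, hc, H⟩ := hQ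
  obtain ⟨C', c', hC', hc', H'⟩ := hQ'
  -- The third lower bound on `C` gives `min c c' * m ≥ 2`, so the factor 2 of the union bound is at
  -- most `exp (min c c' / 2 * m)`.
  refine ⟨max (max C C') (2 / min c c'), min c c' / 2, by positivity, by positivity,
    fun n m hm u hu => ?_⟩
  have hn := one_le_dim_of_norm_eq_one hu
  have hcc : 0 < min c c' := lt_min hc hc'
  have h1 : C * n ≤ m := le_trans (by gcongr; exact (le_max_left _ _).trans (le_max_left _ _)) hm
  have h2 : C' * n ≤ m := le_trans (by gcongr; exact (le_max_right _ _).trans (le_max_left _ _)) hm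
  have h3 : 2 / min c c' * 1 ≤ m := le_trans (by gcongr; exact le_max_right _ _) hm
  rw [mul_one, div_le_iff₀ hcc] at h3
  have hsub : {a : Fin m → EuclideanSpace ℝ (Fin n) | ¬ (Q u a ∧ Q' u a)} ⊆
      {a | ¬ Q u a} ∪ {a | ¬ Q' u a} := fun a ha => not_and_or.1 ha
  refine (measure_mono hsub).trans ((measure_union_le _ _).trans
    ((add_le_add (H n m h1 u hu) (H' n m h2 u hu)).trans ?_))
  rw [← ENNReal.ofReal_add (Real.exp_pos _).le (Real.exp_pos _).le]
  refine ENNReal.ofReal_le_ofReal ?_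
  have e1 : Real.exp (-(c * m)) ≤ Real.exp (-(min c c' * m)) := by
    gcongr; exact min_le_left _ _
  have e2 : Real.exp (-(c' * m)) ≤ Real.exp (-(min c c' * m)) := by
    gcongr; exact min_le_right _ _
  have e3 : 2 * Real.exp (-(min c c' * m)) ≤ Real.exp (-(min c c' / 2 * m)) := by
    have : -(min c c' / 2 * m) = min c c' / 2 * m + -(min c c' * m) := by ring
    rw [this, Real.exp_add]
    gcongr
    have := Real.add_one_le_exp (min c c' / 2 * m)
    linarith
  linarith

/-- If a property of pairs of unit vectors holds for each fixed pair with overwhelming probability,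
then it holds simultaneously for all points of some net of the unit sphere. -/
lemma highProb_net {ρ A c : ℝ} (hρ : 0 < ρ) (hc : 0 < c) (hA : 1 ≤ A)
    {G : ∀ {n m : ℕ}, EuclideanSpace ℝ (Fin n) → EuclideanSpace ℝ (Fin n) →
      (Fin m → EuclideanSpace ℝ (Fin n)) → Prop}
    (hG : ∀ (n m : ℕ) (u v : EuclideanSpace ℝ (Fin n)), ‖u‖ = 1 → ‖v‖ = 1 →
      gaussianSample n m {a | ¬ G u v a} ≤ ENNReal.ofReal (A * Real.exp (-(c * m)))) :
    HighProb fun {n _} u a => ∃ s : Finset (EuclideanSpace ℝ (Fin n)), (∀ v ∈ s, ‖v‖ = 1) ∧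
      (∀ v : EuclideanSpace ℝ (Fin n), ‖v‖ = 1 → ∃ w ∈ s, ‖v - w‖ ≤ ρ) ∧ ∀ v ∈ s, G u v a := by
  have hD : 1 ≤ 1 + 2 / ρ := by linarith [div_pos two_pos hρ]
  have hlD := Real.log_nonneg hD
  have hlA := Real.log_nonneg hA
  -- The union bound costs `exp (n log (1 + 2 / ρ) + log A)`, which half of the exponent `c m` pays
  -- for. The `+ 1` keeps `C` positive.
  refine ⟨2 * (Real.log (1 + 2 / ρ) + Real.log A) / c + 1, c / 2, by positivity, by positivity,
    fun n m hm u hu => ?_⟩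
  have hn := one_le_dim_of_norm_eq_one hu
  obtain ⟨s, hcard, hs, hnet⟩ := exists_net_sphere n hρ
  have hsub : {a : Fin m → EuclideanSpace ℝ (Fin n) |
      ¬ ∃ s : Finset (EuclideanSpace ℝ (Fin n)), (∀ v ∈ s, ‖v‖ = 1) ∧
      (∀ v : EuclideanSpace ℝ (Fin n), ‖v‖ = 1 → ∃ w ∈ s, ‖v - w‖ ≤ ρ) ∧ ∀ v ∈ s, G u v a} ⊆
      ⋃ v ∈ s, {a | ¬ G u v a} := by
    intro a ha
    simp only [Set.mem_iUnion, Set.mem_ofPred_eq, exists_prop]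
    by_contra! hcon
    exact ha ⟨s, hs, hnet, hcon⟩
  refine (measure_mono hsub).trans ((measure_biUnion_finset_le _ _).trans
    ((Finset.sum_le_sum fun v hv => hG n m u v hu (hs v hv)).trans ?_))
  rw [Finset.sum_const, nsmul_eq_mul, ← ENNReal.ofReal_natCast, ← ENNReal.ofReal_mul (by positivity)]
  refine ENNReal.ofReal_le_ofReal ?_
  calc (s.card : ℝ) * (A * Real.exp (-(c * m)))
      ≤ (1 + 2 / ρ) ^ n * (A * Real.exp (-(c * m))) := by gcongr
    _ = Real.exp (n * Real.log (1 + 2 / ρ) + Real.log A + -(c * m)) := by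
      rw [Real.exp_add, Real.exp_add, Real.exp_nat_mul, Real.exp_log (by linarith),
        Real.exp_log (by linarith), mul_assoc]
    _ ≤ Real.exp (-(c / 2 * m)) := by
      refine Real.exp_le_exp.2 ?_
      have h1 : 2 * (Real.log (1 + 2 / ρ) + Real.log A) / c * n ≤ m := by nlinarith
      rw [div_mul_eq_mul_div, div_le_iff₀ hc] at h1
      nlinarith

/-! ### Moments of Gaussian marginals. -/

section GaussianMarginals

variable {n : ℕ}

lemma map_inner_stdGaussian (v : EuclideanSpace ℝ (Fin n)) :
    (stdGaussian (EuclideanSpace ℝ (Fin n))).map (fun a => inner ℝ a v) =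
      (gaussianReal 0 1).map (fun x => ‖v‖ * x) := by
  have h := IsGaussian.map_eq_gaussianReal (μ := stdGaussian (EuclideanSpace ℝ (Fin n)))
    (innerSL ℝ v)
  rw [integral_strongDual_stdGaussian, variance_dual_stdGaussian, innerSL_apply_norm] at h
  have e : (fun a : EuclideanSpace ℝ (Fin n) => inner ℝ a v) = ⇑(innerSL ℝ v) := by
    ext a; simp [real_inner_comm]
  rw [e, h, gaussianReal_map_const_mul]
  congr 1
  · simp
  · ext; simp

lemma integral_comp_inner_stdGaussian (v : EuclideanSpace ℝ (Fin n)) {φ : ℝ → ℝ}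
    (hφ : Measurable φ) :
    ∫ a, φ (inner ℝ a v) ∂stdGaussian (EuclideanSpace ℝ (Fin n)) =
      ∫ x, φ (‖v‖ * x) ∂gaussianReal 0 1 := by
  rw [← integral_map (φ := fun a : EuclideanSpace ℝ (Fin n) => inner ℝ a v) (by fun_prop)
    hφ.aestronglyMeasurable, map_inner_stdGaussian, integral_map (by fun_prop)
    hφ.aestronglyMeasurable]

lemma integrable_comp_inner_stdGaussian (v : EuclideanSpace ℝ (Fin n)) {φ : ℝ → ℝ}
    (hφ : Measurable φ) (hi : Integrable (fun x => φ (‖v‖ * x)) (gaussianReal 0 1)) :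
    Integrable (fun a => φ (inner ℝ a v)) (stdGaussian (EuclideanSpace ℝ (Fin n))) := by
  have h1 : Integrable φ ((gaussianReal 0 1).map (fun x => ‖v‖ * x)) :=
    (integrable_map_measure hφ.aestronglyMeasurable (by fun_prop)).2 hi
  rw [← map_inner_stdGaussian] at h1
  exact (integrable_map_measure hφ.aestronglyMeasurable (by fun_prop)).1 h1

lemma integrable_pow_gaussianReal (j : ℕ) : Integrable (fun x : ℝ => x ^ j) (gaussianReal 0 1) := by
  rcases Nat.eq_zero_or_pos j with rfl | hj
  · simp
  refine (MemLp.integrable_norm_pow (μ := gaussianReal 0 1) (f := id) (p := j)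
    (by exact_mod_cast memLp_id_gaussianReal (j : NNReal)) hj.ne').mono'
    (by fun_prop) (Filter.Eventually.of_forall fun x => by simp)

/-- The moments of the standard normal distribution. -/
noncomputable def gaussianMoment (j : ℕ) : ℝ := ∫ x, x ^ j ∂gaussianReal 0 1

/-- These derivatives of the moment generating function at 0 are the second and fourth moments of
the standard normal law. -/
lemma iteratedDeriv_exp_half_sq :
    iteratedDeriv 2 (fun t : ℝ => Real.exp (t ^ 2 / 2)) 0 = 1 ∧
    iteratedDeriv 4 (fun t : ℝ => Real.exp (t ^ 2 / 2)) 0 = 3 := by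
  have h0 : ∀ t : ℝ, HasDerivAt (fun t : ℝ => Real.exp (t ^ 2 / 2))
      (t * Real.exp (t ^ 2 / 2)) t := fun t => by
    convert! ((hasDerivAt_pow 2 t).div_const 2).exp using 1
    simp; ring
  have hmul : ∀ f f' g : ℝ → ℝ, (∀ t, HasDerivAt f (f' t) t) → (∀ t, f' t + t * f t = g t) →
      deriv (fun t : ℝ => f t * Real.exp (t ^ 2 / 2)) = fun t => g t * Real.exp (t ^ 2 / 2) :=
    fun f f' g hf hg => funext fun t => by
      rw [← hg t]
      exact ((hf t).mul (h0 t)).deriv.trans (by ring)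
  have d1 : deriv (fun t : ℝ => Real.exp (t ^ 2 / 2)) = fun t => t * Real.exp (t ^ 2 / 2) :=
    funext fun t => (h0 t).deriv
  have d2 := hmul (fun t => t) (fun _ => 1) (fun t => 1 + t ^ 2) (fun t => hasDerivAt_id' t)
    (fun t => by ring)
  have d3 := hmul (fun t => 1 + t ^ 2) (fun t => 2 * t) (fun t => 3 * t + t ^ 3)
    (fun t => by simpa using (hasDerivAt_pow 2 t).const_add 1) (fun t => by ring)
  have d4 := hmul (fun t => 3 * t + t ^ 3) (fun t => 3 + 3 * t ^ 2)
    (fun t => 3 + 6 * t ^ 2 + t ^ 4)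
    (fun t => by simpa using! ((hasDerivAt_id' t).const_mul 3).add (hasDerivAt_pow 3 t))
    (fun t => by ring)
  constructor
  · simp [iteratedDeriv_succ, iteratedDeriv_zero, d1, d2]
  · simp [iteratedDeriv_succ, iteratedDeriv_zero, d1, d2, d3, d4]

lemma gaussianMoment_eq_iteratedDeriv (j : ℕ) :
    gaussianMoment j = iteratedDeriv j (fun t : ℝ => Real.exp (t ^ 2 / 2)) 0 := by
  have h := iteratedDeriv_mgf_zero (X := id) (μ := gaussianReal 0 1) (by simp) j
  rw [mgf_id_gaussianReal] at h
  simp only [zero_mul, NNReal.coe_one, one_mul, zero_add] at h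
  rw [h, gaussianMoment]
  rfl

lemma gaussianMoment_two : gaussianMoment 2 = 1 := by
  rw [gaussianMoment_eq_iteratedDeriv, iteratedDeriv_exp_half_sq.1]

lemma gaussianMoment_four : gaussianMoment 4 = 3 := by
  rw [gaussianMoment_eq_iteratedDeriv, iteratedDeriv_exp_half_sq.2]

lemma integral_inner_pow (v : EuclideanSpace ℝ (Fin n)) (j : ℕ) :
    ∫ a, inner ℝ a v ^ j ∂stdGaussian (EuclideanSpace ℝ (Fin n)) = ‖v‖ ^ j * gaussianMoment j := by
  rw [integral_comp_inner_stdGaussian v (φ := fun x => x ^ j) (by fun_prop), gaussianMoment,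
    ← integral_const_mul]
  simp only [mul_pow]

lemma integrable_inner_pow (v : EuclideanSpace ℝ (Fin n)) (j : ℕ) :
    Integrable (fun a => inner ℝ a v ^ j) (stdGaussian (EuclideanSpace ℝ (Fin n))) := by
  refine integrable_comp_inner_stdGaussian v (φ := fun x => x ^ j) (by fun_prop) ?_
  simp only [mul_pow]
  exact (integrable_pow_gaussianReal j).const_mul _

lemma integrable_inner_pow_mul_inner_pow (v u : EuclideanSpace ℝ (Fin n)) (i j : ℕ) :
    Integrable (fun a => inner ℝ a v ^ i * inner ℝ a u ^ j)
      (stdGaussian (EuclideanSpace ℝ (Fin n))) := by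
  refine ((integrable_inner_pow v (2 * i)).add (integrable_inner_pow u (2 * j))).mono'
    (by fun_prop) (Filter.Eventually.of_forall fun a => ?_)
  simp only [Pi.add_apply, pow_mul', norm_mul, Real.norm_eq_abs]
  have h := two_mul_le_add_sq (|inner ℝ a v ^ i|) (|inner ℝ a u ^ j|)
  have h0 : 0 ≤ |inner ℝ a v ^ i| * |inner ℝ a u ^ j| := by positivity
  simp only [sq_abs] at h
  linarith

/-- The mixed fourth moments of two linear marginals of a standard Gaussian vector. -/
lemma integral_inner_quartic (v u : EuclideanSpace ℝ (Fin n)) (hv : ‖v‖ = 1) (hu : ‖u‖ = 1) :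
    (∫ a, inner ℝ a v ^ 4 * inner ℝ a u ^ 0 ∂stdGaussian (EuclideanSpace ℝ (Fin n)) = 3) ∧
    (∫ a, inner ℝ a v ^ 3 * inner ℝ a u ^ 1 ∂stdGaussian (EuclideanSpace ℝ (Fin n)) =
      3 * inner ℝ v u) ∧
    (∫ a, inner ℝ a v ^ 2 * inner ℝ a u ^ 2 ∂stdGaussian (EuclideanSpace ℝ (Fin n)) =
      1 + 2 * inner ℝ v u ^ 2) ∧
    (∫ a, inner ℝ a v ^ 1 * inner ℝ a u ^ 3 ∂stdGaussian (EuclideanSpace ℝ (Fin n)) =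
      3 * inner ℝ v u) ∧
    (∫ a, inner ℝ a v ^ 0 * inner ℝ a u ^ 4 ∂stdGaussian (EuclideanSpace ℝ (Fin n)) = 3) := by
  have hI := integrable_inner_pow_mul_inner_pow v u
  set I : ℕ → ℕ → ℝ := fun i j =>
    ∫ a, inner ℝ a v ^ i * inner ℝ a u ^ j ∂stdGaussian (EuclideanSpace ℝ (Fin n)) with hIdef
  -- Polarization: `⟨a, v + τ u⟩` is Gaussian, so its fourth moment is `3‖v + τ u‖⁴`. This is a
  -- polynomial identity in `τ` of degree 4, and five values of `τ` determine the five mixed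
  -- moments.
  have key : ∀ τ : ℝ, I 4 0 + 4 * τ * I 3 1 + 6 * τ ^ 2 * I 2 2 + 4 * τ ^ 3 * I 1 3 +
      τ ^ 4 * I 0 4 = 3 * (1 + 2 * τ * inner ℝ v u + τ ^ 2) ^ 2 := by
    intro τ
    have h1 := integral_inner_pow (v + τ • u) 4
    have h2 : ‖v + τ • u‖ ^ 2 = 1 + 2 * τ * inner ℝ v u + τ ^ 2 := by
      rw [norm_add_sq_real, norm_smul, real_inner_smul_right, hv, hu]
      simp; ring
    rw [gaussianMoment_four, show ‖v + τ • u‖ ^ 4 = (‖v + τ • u‖ ^ 2) ^ 2 by ring, h2] at h1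
    rw [mul_comm 3, ← h1]
    have e : ∀ a : EuclideanSpace ℝ (Fin n), inner ℝ a (v + τ • u) ^ 4 =
        inner ℝ a v ^ 4 * inner ℝ a u ^ 0 + 4 * τ * (inner ℝ a v ^ 3 * inner ℝ a u ^ 1) +
        6 * τ ^ 2 * (inner ℝ a v ^ 2 * inner ℝ a u ^ 2) +
        4 * τ ^ 3 * (inner ℝ a v ^ 1 * inner ℝ a u ^ 3) +
        τ ^ 4 * (inner ℝ a v ^ 0 * inner ℝ a u ^ 4) := fun a => by
      rw [inner_add_right, real_inner_smul_right]; ring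
    simp only [e]
    rw [integral_add, integral_add, integral_add, integral_add]
    · simp only [integral_const_mul, hIdef]
    · exact hI 4 0
    · exact (hI 3 1).const_mul _
    · exact (hI 4 0).add ((hI 3 1).const_mul _)
    · exact (hI 2 2).const_mul _
    · exact ((hI 4 0).add ((hI 3 1).const_mul _)).add ((hI 2 2).const_mul _)
    · exact (hI 1 3).const_mul _
    · exact (((hI 4 0).add ((hI 3 1).const_mul _)).add ((hI 2 2).const_mul _)).add
        ((hI 1 3).const_mul _)
    · exact (hI 0 4).const_mul _
  have k0 := key 0
  have k1 := key 1
  have k2 := key (-1)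
  have k3 := key 2
  have k4 := key (-2)
  change I 4 0 = _ ∧ I 3 1 = _ ∧ I 2 2 = _ ∧ I 1 3 = _ ∧ I 0 4 = _
  ring_nf at k0 k1 k2 k3 k4 ⊢
  refine ⟨?_, ?_, ?_, ?_, ?_⟩ <;> linarith

/-- The squares of all linear marginals have a common exponential moment. -/
lemma exists_integral_exp_inner_sq_le : ∃ c b : ℝ, 0 < c ∧
    ∀ (n : ℕ) (v : EuclideanSpace ℝ (Fin n)), ‖v‖ = 1 →
      Integrable (fun a => Real.exp (c * inner ℝ a v ^ 2))
        (stdGaussian (EuclideanSpace ℝ (Fin n))) ∧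
      ∫ a, Real.exp (c * inner ℝ a v ^ 2) ∂stdGaussian (EuclideanSpace ℝ (Fin n)) ≤
        Real.exp b := by
  obtain ⟨c, hc, hi⟩ := IsGaussian.exists_integrable_exp_sq (gaussianReal 0 1)
  simp only [Real.norm_eq_abs, sq_abs] at hi
  refine ⟨c, ∫ x, Real.exp (c * x ^ 2) ∂gaussianReal 0 1, hc, fun n v hv => ⟨?_, ?_⟩⟩
  · refine integrable_comp_inner_stdGaussian v (φ := fun x => Real.exp (c * x ^ 2)) (by fun_prop) ?_
    simpa [hv] using hi
  · rw [integral_comp_inner_stdGaussian v (φ := fun x => Real.exp (c * x ^ 2)) (by fun_prop)]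
    simp only [hv, one_mul]
    linarith [Real.add_one_le_exp (∫ x, Real.exp (c * x ^ 2) ∂gaussianReal 0 1)]

end GaussianMarginals

/-! ### Uniform bounds over the sphere. -/

/-- With high probability, the empirical second moment matrix is bounded. -/
lemma exists_highProb_empMean_inner_sq_le : ∃ K : ℝ, 1 ≤ K ∧
    HighProb fun {n _} _ a => ∀ w : EuclideanSpace ℝ (Fin n),
      empMean (fun k => inner ℝ (a k) w ^ 2) ≤ K * ‖w‖ ^ 2 := by
  obtain ⟨c, b, hc, hb⟩ := exists_integral_exp_inner_sq_le
  -- The threshold `b + 1` exceeds the logarithmic moment `b` by 1, so Chernoff's bound gives `exp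
  -- (-m)`.
  set K₀ := max ((b + 1) / c) 1 with hK₀
  have hK₀1 : 1 ≤ K₀ := le_max_right _ _
  refine ⟨4 * K₀, by linarith, ?_⟩
  have hnet := highProb_net (ρ := 1 / 2) (A := 1) (c := 1) (by norm_num) one_pos le_rfl
    (G := fun {n _} _ v a => empMean (fun k => inner ℝ (a k) v ^ 2) ≤ K₀) ?_
  · refine hnet.mono fun {n m} u a hu ⟨s, hs, hcov, hG⟩ => ?_
    have hsphere : ∀ v : EuclideanSpace ℝ (Fin n), ‖v‖ = 1 →
        empMean (fun k => inner ℝ (a k) v ^ 2) ≤ 4 * K₀ := by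
      have hcomp : IsCompact (Metric.sphere (0 : EuclideanSpace ℝ (Fin n)) 1) := isCompact_sphere _ _
      have hcont : Continuous fun v : EuclideanSpace ℝ (Fin n) =>
          empMean (fun k => inner ℝ (a k) v ^ 2) := by
        unfold empMean; fun_prop
      -- Let `q` be the empirical second moment and `w` a net point within `1/2` of its maximizer
      -- `v₀`. Then `q v₀ ≤ 2 q w + 2 q (v₀ - w) ≤ 2 K₀ + q v₀ / 2`, whence the factor 4.
      obtain ⟨v₀, hv₀, hmax⟩ := hcomp.exists_isMaxOn ⟨u, by simpa using hu⟩ hcont.continuousOn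
      have hhom : ∀ w : EuclideanSpace ℝ (Fin n), empMean (fun k => inner ℝ (a k) w ^ 2) ≤
          ‖w‖ ^ 2 * empMean (fun k => inner ℝ (a k) v₀ ^ 2) := fun w => by
        rcases eq_or_ne w 0 with rfl | hw
        · simp [empMean]
        have hw' := norm_ne_zero_iff.2 hw
        have h1 : ‖(‖w‖⁻¹ • w)‖ = 1 := by rw [norm_smul]; simp [hw']
        have h2 := hmax (show ‖w‖⁻¹ • w ∈ Metric.sphere (0 : EuclideanSpace ℝ (Fin n)) 1 by
          simpa using h1)
        have h3 : (fun k => inner ℝ (a k) w ^ 2) =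
            fun k => ‖w‖ ^ 2 * inner ℝ (a k) (‖w‖⁻¹ • w) ^ 2 := funext fun k => by
          rw [real_inner_smul_right]; field_simp
        rw [h3, empMean_const_mul]
        exact mul_le_mul_of_nonneg_left h2 (by positivity)
      obtain ⟨w, hw, hdist⟩ := hcov v₀ (by simpa using hv₀)
      have h1 : empMean (fun k => inner ℝ (a k) v₀ ^ 2) ≤
          2 * empMean (fun k => inner ℝ (a k) w ^ 2) +
          2 * empMean (fun k => inner ℝ (a k) (v₀ - w) ^ 2) := by
        rw [← empMean_const_mul, ← empMean_const_mul, ← empMean_add]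
        refine empMean_mono fun k => ?_
        rw [inner_sub_right]
        nlinarith [sq_nonneg (inner ℝ (a k) v₀ - 2 * inner ℝ (a k) w)]
      have h2 := hhom (v₀ - w)
      have h3 : ‖v₀ - w‖ ^ 2 ≤ (1 / 2) ^ 2 := by gcongr
      have h4 : 0 ≤ empMean (fun k => inner ℝ (a k) v₀ ^ 2) := empMean_nonneg fun k => sq_nonneg _
      have h5 := hG w hw
      intro v hv
      have h6 : empMean (fun k => inner ℝ (a k) v ^ 2) ≤
          empMean (fun k => inner ℝ (a k) v₀ ^ 2) := hmax (by simpa using hv)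
      nlinarith
    intro w
    rcases eq_or_ne w 0 with rfl | hw
    · simp [empMean]
    have hw' := norm_ne_zero_iff.2 hw
    have h3 : (fun k => inner ℝ (a k) w ^ 2) =
        fun k => ‖w‖ ^ 2 * inner ℝ (a k) (‖w‖⁻¹ • w) ^ 2 := funext fun k => by
      rw [real_inner_smul_right]; field_simp
    rw [h3, empMean_const_mul, mul_comm]
    exact mul_le_mul_of_nonneg_right (hsphere _ (by rw [norm_smul]; simp [hw'])) (by positivity)
  · intro n m u v _ hv
    have h := gaussianSample_empMean_gt_le (m := m) (K := b + 1) (hb n v hv).1 (hb n v hv).2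
    refine (measure_mono fun a ha => ?_).trans (h.trans (le_of_eq (by ring_nf)))
    simp only [Set.mem_ofPred_eq, not_le] at ha ⊢
    rw [empMean_const_mul]
    have := (le_max_left _ _).trans_lt ha
    rwa [div_lt_iff₀' hc] at this

/-- A uniform law of large numbers: the empirical mean of `F ⟨a, v⟩ ⟨a, u⟩` is close to its
expectation, uniformly over the unit vectors `v`. -/
lemma highProb_uniform_lln {F : ℝ → ℝ → ℝ} (hF : Measurable (Function.uncurry F)) {B L ε : ℝ}
    (hB : ∀ s t, |F s t| ≤ B) (hL : ∀ s s' t, |F s t - F s' t| ≤ L * |s - s'|) (hε : 0 < ε) :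
    HighProb fun {n _} u a => ∀ v : EuclideanSpace ℝ (Fin n), ‖v‖ = 1 →
      |(empMean fun k => F (inner ℝ (a k) v) (inner ℝ (a k) u)) -
        ∫ x, F (inner ℝ x v) (inner ℝ x u) ∂stdGaussian (EuclideanSpace ℝ (Fin n))| ≤ ε := by
  obtain ⟨K, hK1, hK⟩ := exists_highProb_empMean_inner_sq_le
  have hL0 : 0 ≤ L := by
    have := (abs_nonneg _).trans (hL 1 0 0)
    simpa using this
  have hB0 : 0 ≤ B := (abs_nonneg _).trans (hB 0 0)
  have hmeas : ∀ {n : ℕ} (v u : EuclideanSpace ℝ (Fin n)),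
      Measurable fun x : EuclideanSpace ℝ (Fin n) => F (inner ℝ x v) (inner ℝ x u) := fun v u =>
    hF.comp (by fun_prop : Measurable fun x => (inner ℝ x v, inner ℝ x u))
  have hint : ∀ {n : ℕ} (v u : EuclideanSpace ℝ (Fin n)), Integrable
      (fun x : EuclideanSpace ℝ (Fin n) => F (inner ℝ x v) (inner ℝ x u))
      (stdGaussian (EuclideanSpace ℝ (Fin n))) := fun v u =>
    (integrable_const B).mono' (hmeas v u).aestronglyMeasurable
      (Filter.Eventually.of_forall fun x => hB _ _)
  -- Passing to a net point costs at most `L K ρ ≤ ε / 3`, once for the empirical mean and once for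
  -- the expectation; the deviation at the net point takes the last third.
  set ρ := ε / (3 * ((L + 1) * K)) with hρ
  have hρ0 : 0 < ρ := by positivity
  have hLρ : L * (K * ρ) ≤ ε / 3 := by
    have : L * (K * ρ) = L / (L + 1) * (ε / 3) := by rw [hρ]; field_simp
    rw [this]
    have : L / (L + 1) ≤ 1 := by rw [div_le_one (by linarith)]; linarith
    nlinarith
  -- The weighted inequality `|s| ≤ ρ / 2 + s² / (2 ρ)` replaces first moments by second moments,
  -- which are controlled uniformly in the direction.
  have hscale : ∀ {n : ℕ} (w : EuclideanSpace ℝ (Fin n)), ‖w‖ ≤ ρ →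
      ∀ x : EuclideanSpace ℝ (Fin n), |inner ℝ x w| ≤ ρ / 2 + inner ℝ x w ^ 2 / (2 * ρ) := by
    intro n w _ x
    rw [← sub_nonneg]
    have : ρ / 2 + inner ℝ x w ^ 2 / (2 * ρ) - |inner ℝ x w| =
        (ρ - |inner ℝ x w|) ^ 2 / (2 * ρ) := by
      rw [← sq_abs (inner ℝ x w)]; field_simp; ring
    rw [this]; positivity
  have hnet := highProb_net (ρ := ρ) (A := 2) (c := (ε / 3) ^ 2 / (2 * (B + 1) ^ 2)) hρ0
    (by positivity) (by norm_num)
    (G := fun {n _} u v a => |(empMean fun k => F (inner ℝ (a k) v) (inner ℝ (a k) u)) -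
        ∫ x, F (inner ℝ x v) (inner ℝ x u) ∂stdGaussian (EuclideanSpace ℝ (Fin n))| ≤ ε / 3) ?_
  · refine (hK.and hnet).mono fun {n m} u a hu ⟨hq, s, hs, hcov, hG⟩ v hv => ?_
    obtain ⟨w, hw, hd⟩ := hcov v hv
    -- Equality fails for `m = 0`, where the empirical mean is 0.
    have hmpos : empMean (fun _ : Fin m => ρ / 2) ≤ ρ / 2 := by
      rcases Nat.eq_zero_or_pos m with rfl | hm
      · simp only [empMean, Finset.univ_eq_empty, Finset.sum_empty, mul_zero]; positivity
      · have : (m : ℝ) ≠ 0 := by exact_mod_cast hm.ne'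
        simp only [empMean, Finset.sum_const, Finset.card_univ, Fintype.card_fin, nsmul_eq_mul]
        apply le_of_eq; field_simp
    have h1 : |(empMean fun k => F (inner ℝ (a k) v) (inner ℝ (a k) u)) -
        empMean fun k => F (inner ℝ (a k) w) (inner ℝ (a k) u)| ≤ ε / 3 := by
      rw [← empMean_sub]
      have hd2 : ‖v - w‖ ^ 2 ≤ ρ ^ 2 := by gcongr
      calc _ ≤ empMean fun k => L * (ρ / 2 + (1 / (2 * ρ)) * inner ℝ (a k) (v - w) ^ 2) := by
            refine abs_empMean_le fun k => (hL _ _ _).trans ?_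
            rw [← inner_sub_right]
            refine mul_le_mul_of_nonneg_left ((hscale _ hd _).trans (le_of_eq ?_)) hL0
            ring
        _ = L * (empMean (fun _ : Fin m => ρ / 2) +
            (1 / (2 * ρ)) * empMean fun k => inner ℝ (a k) (v - w) ^ 2) := by
            rw [empMean_const_mul, empMean_add, empMean_const_mul]
        _ ≤ L * (K * ρ) := by
            refine mul_le_mul_of_nonneg_left ?_ hL0
            have h3 : (1 / (2 * ρ)) * empMean (fun k => inner ℝ (a k) (v - w) ^ 2) ≤
                (1 / (2 * ρ)) * (K * ρ ^ 2) := by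
              refine mul_le_mul_of_nonneg_left ((hq (v - w)).trans ?_) (by positivity)
              gcongr
            have h4 : (1 / (2 * ρ)) * (K * ρ ^ 2) = K * ρ / 2 := by field_simp
            nlinarith
        _ ≤ ε / 3 := hLρ
    have h2 : |∫ x, F (inner ℝ x v) (inner ℝ x u) ∂stdGaussian (EuclideanSpace ℝ (Fin n)) -
        ∫ x, F (inner ℝ x w) (inner ℝ x u) ∂stdGaussian (EuclideanSpace ℝ (Fin n))| ≤ ε / 3 := by
      rw [← integral_sub (hint v u) (hint w u)]
      have hsq := integrable_inner_pow (v - w) 2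
      calc _ ≤ ∫ x, L * (ρ / 2 + (1 / (2 * ρ)) * inner ℝ x (v - w) ^ 2)
              ∂stdGaussian (EuclideanSpace ℝ (Fin n)) := by
            refine norm_integral_le_of_norm_le
              (f := fun x => F (inner ℝ x v) (inner ℝ x u) - F (inner ℝ x w) (inner ℝ x u))
              (g := fun x => L * (ρ / 2 + (1 / (2 * ρ)) * inner ℝ x (v - w) ^ 2))
              (((integrable_const _).add (hsq.const_mul _)).const_mul _)
              (Filter.Eventually.of_forall fun x => (hL _ _ _).trans ?_)
            rw [← inner_sub_right]
            refine mul_le_mul_of_nonneg_left ((hscale _ hd _).trans (le_of_eq ?_)) hL0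
            ring
        _ = L * (ρ / 2 + (1 / (2 * ρ)) * ‖v - w‖ ^ 2) := by
            rw [integral_const_mul, integral_add (integrable_const _) (hsq.const_mul _),
              integral_const_mul, integral_inner_pow, gaussianMoment_two]
            simp
        _ ≤ L * (K * ρ) := by
            refine mul_le_mul_of_nonneg_left ?_ hL0
            have h3 : (1 / (2 * ρ)) * ‖v - w‖ ^ 2 ≤ (1 / (2 * ρ)) * ρ ^ 2 := by gcongr
            have h4 : (1 / (2 * ρ)) * ρ ^ 2 = ρ / 2 := by field_simp
            nlinarith
        _ ≤ ε / 3 := hLρ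
    have h3 := hG w hw
    rw [abs_le] at *
    constructor <;> linarith [h1.1, h1.2, h2.1, h2.2, h3.1, h3.2]
  · intro n m u v _ _
    have hp := gaussianSample_empMean_sub_integral_gt_le (m := m) (hmeas v u)
      (by linarith : 0 < B + 1) (by positivity : 0 < ε / 3)
      (fun x => (hB _ _).trans (by linarith))
    have hn := gaussianSample_empMean_sub_integral_gt_le (m := m) (hmeas v u).neg
      (by linarith : 0 < B + 1) (by positivity : 0 < ε / 3)
      (fun x => by rw [Pi.neg_apply, abs_neg]; exact (hB _ _).trans (by linarith))
    rw [two_mul, ENNReal.ofReal_add (Real.exp_pos _).le (Real.exp_pos _).le]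
    refine (measure_mono fun a ha => ?_).trans ((measure_union_le _ _).trans (add_le_add hp hn))
    simp only [Set.mem_union, Set.mem_ofPred_eq, not_le, Pi.neg_apply, integral_neg, lt_abs] at ha ⊢
    refine ha.imp id fun h => ?_
    have : (empMean fun k => -F (inner ℝ (a k) v) (inner ℝ (a k) u)) =
        -empMean fun k => F (inner ℝ (a k) v) (inner ℝ (a k) u) := by
      simp [empMean]
    rw [this]; linarith

/-! ### Truncated monomials and their moments. -/

/-- Truncation of a real number to `[-R, R]`. -/
noncomputable def clip (R s : ℝ) : ℝ := max (-R) (min R s)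

section Clip

variable {R : ℝ}

@[fun_prop]
lemma measurable_clip : Measurable (clip R) := by
  unfold clip; fun_prop

lemma abs_clip_le (hR : 0 ≤ R) (s : ℝ) : |clip R s| ≤ R :=
  abs_le.2 ⟨le_max_left _ _, max_le (by linarith) (min_le_left _ _)⟩

lemma clip_of_abs_le {s : ℝ} (hs : |s| ≤ R) : clip R s = s := by
  rw [clip, min_eq_right (abs_le.1 hs).2, max_eq_right (abs_le.1 hs).1]

lemma abs_clip_of_le_abs (hR : 0 ≤ R) {s : ℝ} (hs : R ≤ |s|) : |clip R s| = R := by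
  rcases le_abs.1 hs with h | h
  · rw [clip, min_eq_left h, max_eq_right (by linarith), abs_of_nonneg hR]
  · rw [clip, min_eq_right (by linarith), max_eq_left (by linarith), abs_neg, abs_of_nonneg hR]

lemma exists_clip_eq_mul (hR : 0 < R) (s : ℝ) : ∃ θ, 0 ≤ θ ∧ θ ≤ 1 ∧ clip R s = θ * s := by
  rcases le_or_gt |s| R with h | h
  · exact ⟨1, zero_le_one, le_rfl, by rw [clip_of_abs_le h, one_mul]⟩
  have hs : 0 < |s| := hR.trans h
  refine ⟨R / |s|, by positivity, (div_le_one hs).2 h.le, ?_⟩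
  rcases lt_abs.1 h with h' | h'
  · have : 0 < s := by linarith
    rw [abs_of_pos this, clip, min_eq_left h'.le, max_eq_right (by linarith)]
    field_simp
  · have : s < 0 := by linarith
    rw [abs_of_neg this, clip, min_eq_right (by linarith), max_eq_left (by linarith)]
    have := this.ne
    field_simp

lemma abs_clip_sub_clip_le (s s' : ℝ) : |clip R s - clip R s'| ≤ |s - s'| := by
  unfold clip
  refine (abs_max_sub_max_le_max _ _ _ _).trans ?_
  rw [sub_self, abs_zero, max_eq_right (abs_nonneg _)]
  refine (abs_min_sub_min_le_max _ _ _ _).trans ?_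
  rw [sub_self, abs_zero, max_eq_right (abs_nonneg _)]

lemma abs_mul_clip_pow_le (hR : 0 ≤ R) (s t : ℝ) (i j : ℕ) :
    |clip R s ^ i * clip R t ^ j| ≤ R ^ (i + j) := by
  rw [abs_mul, abs_pow, abs_pow, pow_add]
  gcongr <;> exact abs_clip_le hR _

/-- Only the first argument varies: the second belongs to the fixed signal direction, so the net
covers one sphere. -/
lemma abs_mul_clip_pow_sub_le (hR : 0 ≤ R) (s s' t : ℝ) (i j : ℕ) :
    |clip R s ^ i * clip R t ^ j - clip R s' ^ i * clip R t ^ j| ≤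
      (i * R ^ (i - 1) * R ^ j) * |s - s'| := by
  rw [← sub_mul, abs_mul, abs_pow (clip R t)]
  have h1 := abs_pow_sub_pow_le (clip R s) (clip R s') i
  have h2 : |clip R t| ^ j ≤ R ^ j := by gcongr; exact abs_clip_le hR t
  have h3 : max |clip R s| |clip R s'| ^ (i - 1) ≤ R ^ (i - 1) := by
    gcongr; exact max_le (abs_clip_le hR _) (abs_clip_le hR _)
  calc _ ≤ (|s - s'| * i * R ^ (i - 1)) * R ^ j := by
        gcongr
        refine h1.trans ?_
        have := abs_clip_sub_clip_le (R := R) s s'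
        exact mul_le_mul (mul_le_mul_of_nonneg_right this (by positivity)) h3 (by positivity)
          (by positivity)
    _ = _ := by ring

/-- Clipping preserves signs and shrinks, so a clipped monomial and a cutoff-weighted one are both
the same monomial times a factor in `[0, 1]`. -/
lemma exists_mul_clip_pow_eq (hR : 0 < R) (s t : ℝ) (i j : ℕ) : ∃ θ, 0 ≤ θ ∧ θ ≤ 1 ∧
    clip R s ^ i * clip R t ^ j = θ * (s ^ i * t ^ j) := by
  obtain ⟨θ, h0, h1, h⟩ := exists_clip_eq_mul hR s
  obtain ⟨θ', h0', h1', h'⟩ := exists_clip_eq_mul hR t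
  refine ⟨θ ^ i * θ' ^ j, by positivity, mul_le_one₀ (pow_le_one₀ h0 h1) (by positivity)
    (pow_le_one₀ h0' h1'), ?_⟩
  rw [h, h']; ring

lemma abs_pow_mul_pow_le {s t D : ℝ} (hs : s ^ 2 ≤ D) (ht : t ^ 2 ≤ D) {i j : ℕ}
    (hij : i + j = 4) : |s ^ i * t ^ j| ≤ D ^ 2 := by
  have hD : 0 ≤ D := (sq_nonneg s).trans hs
  have hs' : |s| ≤ √D := Real.le_sqrt_of_sq_le (by rwa [sq_abs])
  have ht' : |t| ≤ √D := Real.le_sqrt_of_sq_le (by rwa [sq_abs])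
  calc |s ^ i * t ^ j| = |s| ^ i * |t| ^ j := by rw [abs_mul, abs_pow, abs_pow]
    _ ≤ √D ^ i * √D ^ j := by gcongr
    _ = (√D ^ 2) ^ 2 := by rw [← pow_add, hij, ← pow_mul]
    _ = D ^ 2 := by rw [Real.sq_sqrt hD]

/-- A difference requires `R² ≤ s² + t²`. The monomial is at most `(s² + t²)²`, and an extra factor
`(s² + t²) / R² ≥ 1` trades two more powers for `R⁻²`. -/
lemma abs_mul_clip_pow_sub_mul_pow_le (hR : 0 < R) (s t : ℝ) {i j : ℕ} (hij : i + j = 4) :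
    |clip R s ^ i * clip R t ^ j - s ^ i * t ^ j| ≤ 4 / R ^ 2 * (s ^ 6 + t ^ 6) := by
  by_cases h : |s| ≤ R ∧ |t| ≤ R
  · rw [clip_of_abs_le h.1, clip_of_abs_le h.2, sub_self, abs_zero]
    positivity
  have hRle : R ^ 2 ≤ s ^ 2 + t ^ 2 := by
    rcases not_and_or.1 h with h | h <;> push Not at h
    · have : R ^ 2 ≤ |s| ^ 2 := by gcongr
      rw [sq_abs] at this; nlinarith [sq_nonneg t]
    · have : R ^ 2 ≤ |t| ^ 2 := by gcongr
      rw [sq_abs] at this; nlinarith [sq_nonneg s]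
  obtain ⟨θ, h0, h1, hθ⟩ := exists_mul_clip_pow_eq hR s t i j
  have hq : |s ^ i * t ^ j| ≤ (s ^ 2 + t ^ 2) ^ 2 :=
    abs_pow_mul_pow_le (by nlinarith [sq_nonneg t]) (by nlinarith [sq_nonneg s]) hij
  have hθ' : |θ - 1| ≤ 1 := abs_le.2 ⟨by linarith, by linarith⟩
  rw [hθ, show θ * (s ^ i * t ^ j) - s ^ i * t ^ j = (θ - 1) * (s ^ i * t ^ j) by ring, abs_mul]
  have h2 : |θ - 1| * |s ^ i * t ^ j| ≤ (s ^ 2 + t ^ 2) ^ 2 := by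
    nlinarith [abs_nonneg (s ^ i * t ^ j), abs_nonneg (θ - 1)]
  refine h2.trans ?_
  rw [div_mul_eq_mul_div, le_div_iff₀ (by positivity)]
  calc (s ^ 2 + t ^ 2) ^ 2 * R ^ 2 ≤ (s ^ 2 + t ^ 2) ^ 2 * (s ^ 2 + t ^ 2) := by gcongr
    _ ≤ 4 * (s ^ 6 + t ^ 6) := by
      nlinarith [mul_nonneg (add_nonneg (sq_nonneg s) (sq_nonneg t)) (sq_nonneg (s ^ 2 - t ^ 2))]

end Clip

lemma measurable_mul_clip_pow (R : ℝ) (i j : ℕ) :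
    Measurable (Function.uncurry fun s t : ℝ => clip R s ^ i * clip R t ^ j) := by
  unfold Function.uncurry; fun_prop

section Moments

variable {n : ℕ} {R : ℝ}

lemma integrable_mul_clip_pow (hR : 0 ≤ R) (v u : EuclideanSpace ℝ (Fin n)) (i j : ℕ) :
    Integrable (fun a => clip R (inner ℝ a v) ^ i * clip R (inner ℝ a u) ^ j)
      (stdGaussian (EuclideanSpace ℝ (Fin n))) :=
  (integrable_const (R ^ (i + j))).mono' (by fun_prop)
    (Filter.Eventually.of_forall fun _ => abs_mul_clip_pow_le hR _ _ i j)

lemma abs_integral_mul_clip_pow_sub_le (hR : 0 < R) (v u : EuclideanSpace ℝ (Fin n))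
    (hv : ‖v‖ = 1) (hu : ‖u‖ = 1) {i j : ℕ} (hij : i + j = 4) :
    |∫ a, clip R (inner ℝ a v) ^ i * clip R (inner ℝ a u) ^ j
        ∂stdGaussian (EuclideanSpace ℝ (Fin n)) -
      ∫ a, inner ℝ a v ^ i * inner ℝ a u ^ j ∂stdGaussian (EuclideanSpace ℝ (Fin n))| ≤
      8 * gaussianMoment 6 / R ^ 2 := by
  rw [← integral_sub (integrable_mul_clip_pow hR.le v u i j)
    (integrable_inner_pow_mul_inner_pow v u i j)]
  refine (norm_integral_le_of_norm_le
    (f := fun a => clip R (inner ℝ a v) ^ i * clip R (inner ℝ a u) ^ j -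
      inner ℝ a v ^ i * inner ℝ a u ^ j)
    (g := fun a => 4 / R ^ 2 * (inner ℝ a v ^ 6 + inner ℝ a u ^ 6))
    (((integrable_inner_pow v 6).add (integrable_inner_pow u 6)).const_mul _)
    (Filter.Eventually.of_forall fun a => abs_mul_clip_pow_sub_mul_pow_le hR _ _ hij)).trans
    (le_of_eq ?_)
  rw [integral_const_mul, integral_add (integrable_inner_pow v 6) (integrable_inner_pow u 6),
    integral_inner_pow, integral_inner_pow, hv, hu]
  ring

lemma integral_clip_pow_le (hR : 0 < R) (v u : EuclideanSpace ℝ (Fin n)) (hv : ‖v‖ = 1)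
    {i : ℕ} (hi : Even i) :
    ∫ a, clip R (inner ℝ a v) ^ i * clip R (inner ℝ a u) ^ 0
        ∂stdGaussian (EuclideanSpace ℝ (Fin n)) ≤ gaussianMoment i := by
  have h := integral_inner_pow v i
  rw [hv, one_pow, one_mul] at h
  rw [← h]
  refine integral_mono (integrable_mul_clip_pow hR.le v u i 0) (integrable_inner_pow v i) fun a => ?_
  obtain ⟨θ, h0, h1, hθ⟩ := exists_mul_clip_pow_eq hR (inner ℝ a v) (inner ℝ a u) i 0
  simp only [pow_zero, mul_one] at hθ ⊢
  nlinarith [hi.pow_nonneg (inner ℝ a v)]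

/-- Pointwise `clip R s ^ 2 ≥ s² - s⁴ / R²`, the right side being nonpositive once `|s| ≥ R`; the
moments 1 and 3 are then inserted. -/
lemma le_integral_clip_sq (hR : 0 < R) (v u : EuclideanSpace ℝ (Fin n)) (hv : ‖v‖ = 1) :
    1 - 3 / R ^ 2 ≤ ∫ a, clip R (inner ℝ a v) ^ 2 * clip R (inner ℝ a u) ^ 0
        ∂stdGaussian (EuclideanSpace ℝ (Fin n)) := by
  have h2 := integral_inner_pow v 2
  have h4 := integral_inner_pow v 4
  rw [hv, one_pow, one_mul, gaussianMoment_two] at h2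
  rw [hv, one_pow, one_mul, gaussianMoment_four] at h4
  have e : 1 - 3 / R ^ 2 = ∫ a, (inner ℝ a v ^ 2 - 1 / R ^ 2 * inner ℝ a v ^ 4)
      ∂stdGaussian (EuclideanSpace ℝ (Fin n)) := by
    rw [integral_sub (integrable_inner_pow v 2) ((integrable_inner_pow v 4).const_mul _),
      integral_const_mul, h2, h4]
    ring
  rw [e]
  refine integral_mono ((integrable_inner_pow v 2).sub ((integrable_inner_pow v 4).const_mul _))
    (integrable_mul_clip_pow hR.le v u 2 0) fun a => ?_
  simp only [pow_zero, mul_one]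
  set s : ℝ := inner ℝ a v
  rcases le_or_gt |s| R with h | h
  · rw [clip_of_abs_le h]
    have : 0 ≤ 1 / R ^ 2 * s ^ 4 := by positivity
    linarith
  · have h' : R ^ 2 ≤ s ^ 2 := by rw [← sq_abs s]; gcongr
    have : s ^ 2 ≤ 1 / R ^ 2 * s ^ 4 := by
      rw [one_div_mul_eq_div, le_div_iff₀ (by positivity)]
      nlinarith [sq_nonneg s]
    nlinarith [sq_nonneg (clip R s)]

end Moments

/-! ### The good event. -/

/-- With high probability, the truncated empirical fourth moments are close to the Gaussian ones,
few marginals exceed the truncation level, and the empirical second moment is bounded below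
and above. The errors are controlled by the truncation level `R`. -/
lemma exists_highProb_truncated_moments : ∃ K A : ℝ, 1 ≤ K ∧ 0 < A ∧ ∀ R : ℝ, 3 ≤ R →
    HighProb fun {n _} u a =>
      (∀ v : EuclideanSpace ℝ (Fin n), ‖v‖ = 1 → ∀ i j : ℕ, i + j = 4 →
        |(empMean fun k => clip R (inner ℝ (a k) v) ^ i * clip R (inner ℝ (a k) u) ^ j) -
          ∫ x, inner ℝ x v ^ i * inner ℝ x u ^ j ∂stdGaussian (EuclideanSpace ℝ (Fin n))| ≤
          A / R ^ 2) ∧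
      (∀ v : EuclideanSpace ℝ (Fin n), ‖v‖ = 1 →
        (empMean fun k => if R < |inner ℝ (a k) v| then (1 : ℝ) else 0) ≤ A / R ^ 12) ∧
      1 / 2 ≤ (empMean fun k => inner ℝ (a k) u ^ 2) ∧
      (empMean fun k => inner ℝ (a k) u ^ 2) ≤ K := by
  obtain ⟨K, hK1, hK⟩ := exists_highProb_empMean_inner_sq_le
  have hm6 : 0 ≤ gaussianMoment 6 := integral_nonneg fun x => by positivity
  have hm12 : 0 ≤ gaussianMoment 12 := integral_nonneg fun x => by positivity
  -- The sixth moment bounds the clipping bias, the twelfth the tails, and the 1 absorbs the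
  -- deviation `1 / R²`.
  refine ⟨K, 8 * gaussianMoment 6 + gaussianMoment 12 + 1, hK1, by positivity, fun R hR => ?_⟩
  have hR0 : 0 < R := by linarith
  have hR2 : 9 ≤ R ^ 2 := by nlinarith
  have hlln : ∀ i j : ℕ, HighProb fun {n _} u a => ∀ v : EuclideanSpace ℝ (Fin n), ‖v‖ = 1 →
      |(empMean fun k => clip R (inner ℝ (a k) v) ^ i * clip R (inner ℝ (a k) u) ^ j) -
        ∫ x, clip R (inner ℝ x v) ^ i * clip R (inner ℝ x u) ^ j
          ∂stdGaussian (EuclideanSpace ℝ (Fin n))| ≤ 1 / R ^ 2 := fun i j =>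
    highProb_uniform_lln (measurable_mul_clip_pow R i j)
      (fun s t => abs_mul_clip_pow_le hR0.le s t i j)
      (fun s s' t => abs_mul_clip_pow_sub_le hR0.le s s' t i j) (by positivity)
  refine (hK.and ((hlln 2 0).and ((hlln 12 0).and ((hlln 4 0).and ((hlln 3 1).and ((hlln 2 2).and
    ((hlln 1 3).and (hlln 0 4)))))))).mono ?_
  rintro n m u a hu ⟨hq, h2, h12, h40, h31, h22, h13, h04⟩
  refine ⟨fun v hv i j hij => ?_, fun v hv => ?_, ?_, ?_⟩
  · have hgap := abs_integral_mul_clip_pow_sub_le hR0 v u hv hu hij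
    have hdev : |(empMean fun k => clip R (inner ℝ (a k) v) ^ i * clip R (inner ℝ (a k) u) ^ j) -
        ∫ x, clip R (inner ℝ x v) ^ i * clip R (inner ℝ x u) ^ j
          ∂stdGaussian (EuclideanSpace ℝ (Fin n))| ≤ 1 / R ^ 2 := by
      obtain ⟨rfl, rfl⟩ | ⟨rfl, rfl⟩ | ⟨rfl, rfl⟩ | ⟨rfl, rfl⟩ | ⟨rfl, rfl⟩ :
        (i = 4 ∧ j = 0) ∨ (i = 3 ∧ j = 1) ∨ (i = 2 ∧ j = 2) ∨ (i = 1 ∧ j = 3) ∨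
          (i = 0 ∧ j = 4) := by omega
      · exact h40 v hv
      · exact h31 v hv
      · exact h22 v hv
      · exact h13 v hv
      · exact h04 v hv
    refine (abs_sub_le _ _ _).trans ((add_le_add hdev hgap).trans ?_)
    rw [← add_div]
    exact div_le_div_of_nonneg_right (by linarith) (by positivity)
  · have hdev := (abs_le.1 (h12 v hv)).2
    have hint := integral_clip_pow_le hR0 v u hv (i := 12) (by decide)
    -- Markov's inequality with the twelfth power: the resulting `R⁻¹²` is of order `β⁻⁶` and
    -- outweighs the `β⁴` size of the cutoff-derivative terms.
    have hle : (empMean fun k => if R < |inner ℝ (a k) v| then (1 : ℝ) else 0) ≤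
        1 / R ^ 12 * empMean fun k =>
          clip R (inner ℝ (a k) v) ^ 12 * clip R (inner ℝ (a k) u) ^ 0 := by
      rw [← empMean_const_mul]
      refine empMean_mono fun k => ?_
      rw [pow_zero, mul_one, ← (by decide : Even 12).pow_abs (clip R _)]
      split_ifs with h
      · rw [abs_clip_of_le_abs hR0.le h.le]
        apply le_of_eq; field_simp
      · positivity
    refine hle.trans ?_
    rw [one_div_mul_eq_div]
    gcongr
    have : 1 / R ^ 2 ≤ 1 := by rw [div_le_one (by positivity)]; linarith
    linarith
  · have hdev := (abs_le.1 (h2 u hu)).1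
    have hint := le_integral_clip_sq hR0 u u hu
    have hle : (empMean fun k => clip R (inner ℝ (a k) u) ^ 2 * clip R (inner ℝ (a k) u) ^ 0) ≤
        empMean fun k => inner ℝ (a k) u ^ 2 := by
      refine empMean_mono fun k => ?_
      obtain ⟨θ, h0, h1, hθ⟩ := exists_mul_clip_pow_eq hR0 (inner ℝ (a k) u) (inner ℝ (a k) u) 2 0
      simp only [pow_zero, mul_one] at hθ ⊢
      nlinarith [sq_nonneg (inner ℝ (a k) u)]
    -- Here `R ≥ 3` leaves `1 - 4/9 ≥ 1/2` for the lower bound.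
    have : 3 / R ^ 2 + 1 / R ^ 2 ≤ 4 / 9 := by
      rw [← add_div, div_le_div_iff₀ (by positivity) (by norm_num)]; linarith
    linarith
  · simpa [hu] using hq u

/-! ### Cutoffs on the real line. -/

/-- A twice differentiable cutoff on the whole real line, equal to `1` up to `β` and to `0` from
`γ` on, whose first two derivatives are bounded by `M`. -/
structure IsCutoff (H : ℝ → ℝ) (β γ M : ℝ) : Prop where
  eq_one : ∀ u ≤ β, H u = 1
  mem_Icc : ∀ u, H u ∈ Set.Icc (0 : ℝ) 1
  eq_zero : ∀ u, γ ≤ u → H u = 0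
  differentiable : Differentiable ℝ H
  differentiable_deriv : Differentiable ℝ (deriv H)
  abs_deriv_le : ∀ u, |deriv H u| ≤ M
  abs_deriv_deriv_le : ∀ u, |deriv (deriv H) u| ≤ M

/-- A one-sided derivative determines the derivative where it exists, so the endpoint `p` is
included although `f` need not be constant near it. -/
lemma deriv_eq_zero_of_eqOn_Iic {f : ℝ → ℝ} {p c : ℝ} (hf : ∀ x ≤ p, f x = c)
    (hd : DifferentiableAt ℝ f p) : deriv f p = 0 := by
  have h1 : HasDerivWithinAt f (deriv f p) (Set.Iic p) p := hd.hasDerivAt.hasDerivWithinAt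
  have h2 : HasDerivWithinAt f 0 (Set.Iic p) p :=
    (hasDerivWithinAt_const p (Set.Iic p) c).congr (fun x hx => hf x hx) (hf p le_rfl)
  exact (uniqueDiffWithinAt_Iic p).eq_deriv _ h1 h2

lemma deriv_eq_zero_of_eqOn_Ici {f : ℝ → ℝ} {p c : ℝ} (hf : ∀ x, p ≤ x → f x = c)
    (hd : DifferentiableAt ℝ f p) : deriv f p = 0 := by
  have h1 : HasDerivWithinAt f (deriv f p) (Set.Ici p) p := hd.hasDerivAt.hasDerivWithinAt
  have h2 : HasDerivWithinAt f 0 (Set.Ici p) p :=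
    (hasDerivWithinAt_const p (Set.Ici p) c).congr (fun x hx => hf x hx) (hf p le_rfl)
  exact (uniqueDiffWithinAt_Ici p).eq_deriv _ h1 h2

namespace IsCutoff

variable {H : ℝ → ℝ} {β γ M : ℝ}

lemma deriv_eq_zero_of_le (hH : IsCutoff H β γ M) {u : ℝ} (hu : u ≤ β) : deriv H u = 0 :=
  deriv_eq_zero_of_eqOn_Iic (fun x hx => hH.eq_one x (hx.trans hu)) (hH.differentiable u)

lemma deriv_eq_zero_of_ge (hH : IsCutoff H β γ M) {u : ℝ} (hu : γ ≤ u) : deriv H u = 0 :=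
  deriv_eq_zero_of_eqOn_Ici (fun x hx => hH.eq_zero x (hu.trans hx)) (hH.differentiable u)

lemma deriv_deriv_eq_zero_of_le (hH : IsCutoff H β γ M) {u : ℝ} (hu : u ≤ β) :
    deriv (deriv H) u = 0 :=
  deriv_eq_zero_of_eqOn_Iic (fun _ hx => hH.deriv_eq_zero_of_le (hx.trans hu))
    (hH.differentiable_deriv u)

lemma deriv_deriv_eq_zero_of_ge (hH : IsCutoff H β γ M) {u : ℝ} (hu : γ ≤ u) :
    deriv (deriv H) u = 0 :=
  deriv_eq_zero_of_eqOn_Ici (fun _ hx => hH.deriv_eq_zero_of_ge (hu.trans hx))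
    (hH.differentiable_deriv u)

lemma nonneg (hH : IsCutoff H β γ M) : 0 ≤ M := (abs_nonneg _).trans (hH.abs_deriv_le 0)

end IsCutoff

/-- An activation function agrees on `[0, ∞)` with a cutoff on the whole real line. -/
lemma IsActivation.exists_isCutoff {h : ℝ → ℝ} {β γ M : ℝ} (hh : IsActivation h β γ M)
    (hβ : 0 < β) (hβγ : β < γ) : ∃ H, IsCutoff H β γ M ∧ ∀ u, 0 ≤ u → h u = H u := by
  -- Extension by 1 removes the uncontrolled behaviour of `h` at and below 0: `H` is `h` on `(0, ∞)`
  -- and 1 on `(-∞, β)`, and these open sets cover the line because `β > 0`.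
  let H : ℝ → ℝ := fun u => if 0 ≤ u then h u else 1
  have hpos : ∀ u, 0 ≤ u → H u = h u := fun u hu => if_pos hu
  have hone : ∀ u ≤ β, H u = 1 := fun u hu => by
    by_cases h0 : 0 ≤ u
    · rw [hpos u h0, hh.eq_one u h0 hu]
    · exact if_neg h0
  have hM : 0 ≤ M := (abs_nonneg _).trans (hh.abs_deriv_le 1 one_pos)
  have hev : ∀ u, 0 < u → H =ᶠ[nhds u] h := fun u hu => by
    filter_upwards [lt_mem_nhds hu] with x hx using hpos x hx.le
  have hev1 : ∀ u, u < β → H =ᶠ[nhds u] fun _ => 1 := fun u hu => by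
    filter_upwards [gt_mem_nhds hu] with x hx using hone x hx.le
  have hevd : ∀ u, 0 < u → deriv H =ᶠ[nhds u] deriv h := fun u hu => (hev u hu).deriv
  have hevd1 : ∀ u, u < β → deriv H =ᶠ[nhds u] fun _ => 0 := fun u hu => by
    have := (hev1 u hu).deriv
    simpa using this
  refine ⟨H, ⟨hone, fun u => ?_, fun u hu => ?_, fun u => ?_, fun u => ?_, fun u => ?_,
    fun u => ?_⟩, fun u hu => (hpos u hu).symm⟩
  · rcases le_or_gt u β with hu | hu
    · rw [hone u hu]; simp
    · rw [hpos u (by linarith)]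
      rcases lt_or_ge u γ with hu' | hu'
      · exact hh.mem_Icc u hu hu'
      · rw [hh.eq_zero u hu']; simp
  · rw [hpos u (by linarith), hh.eq_zero u hu]
  · rcases lt_or_ge u β with hu | hu
    · exact (hev1 u hu).differentiableAt_iff.2 (differentiableAt_const _)
    · exact (hev u (hβ.trans_le hu)).differentiableAt_iff.2
        (hh.differentiableAt u (hβ.trans_le hu))
  · rcases lt_or_ge u β with hu | hu
    · exact (hevd1 u hu).differentiableAt_iff.2 (differentiableAt_const _)
    · exact (hevd u (hβ.trans_le hu)).differentiableAt_iff.2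
        (hh.differentiableAt_deriv u (hβ.trans_le hu))
  · rcases lt_or_ge u β with hu | hu
    · rw [(hevd1 u hu).eq_of_nhds, abs_zero]; exact hM
    · rw [(hevd u (hβ.trans_le hu)).eq_of_nhds]; exact hh.abs_deriv_le u (hβ.trans_le hu)
  · rcases lt_or_ge u β with hu | hu
    · rw [(hevd1 u hu).deriv_eq]; simpa using hM
    · rw [(hevd u (hβ.trans_le hu)).deriv_eq]
      exact hh.abs_deriv_deriv_le u (hβ.trans_le hu)

/-! ### Derivatives of one summand along a line. -/

/-- The derivative of `s² / N` when `s` and `N` vary with velocities `b` and `2 q`. -/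
noncomputable def ratioDeriv (s b q N : ℝ) : ℝ := 2 * s * b / N - 2 * s ^ 2 * q / N ^ 2

/-- The derivative of `ratioDeriv` when moreover `q` varies with velocity `ν`. -/
noncomputable def ratioDeriv₂ (s b q ν N : ℝ) : ℝ :=
  2 * b ^ 2 / N - 8 * s * b * q / N ^ 2 - 2 * s ^ 2 * ν / N ^ 2 + 8 * s ^ 2 * q ^ 2 / N ^ 3

/-- The derivative of `(s² - y)² H(s² / N)` when `s` and `N` vary with velocities `b` and `2 q`. -/
noncomputable def termDeriv (H : ℝ → ℝ) (y s b q N : ℝ) : ℝ :=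
  4 * (s ^ 2 - y) * s * b * H (s ^ 2 / N) + (s ^ 2 - y) ^ 2 * deriv H (s ^ 2 / N) * ratioDeriv s b q N

/-- The derivative of `termDeriv` when moreover `q` varies with velocity `ν`. -/
noncomputable def termDeriv₂ (H : ℝ → ℝ) (y s b q ν N : ℝ) : ℝ :=
  (8 * s ^ 2 * b ^ 2 + 4 * (s ^ 2 - y) * b ^ 2) * H (s ^ 2 / N) +
    8 * (s ^ 2 - y) * s * b * deriv H (s ^ 2 / N) * ratioDeriv s b q N +
    (s ^ 2 - y) ^ 2 * (deriv (deriv H) (s ^ 2 / N) * ratioDeriv s b q N ^ 2 +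
      deriv H (s ^ 2 / N) * ratioDeriv₂ s b q ν N)

section LineDerivatives

variable {s b q ν N : ℝ}

lemma hasDerivAt_line_s : HasDerivAt (fun t => s + t * b) b 0 := by
  simpa using ((hasDerivAt_id (0 : ℝ)).mul_const b).const_add s

/-- With `q = ⟨z, v⟩` and `ν = ‖v‖²` this models `‖z + t v‖²`. -/
lemma hasDerivAt_line_N : HasDerivAt (fun t => N + 2 * t * q + t ^ 2 * ν) (2 * q) 0 := by
  have h1 := (((hasDerivAt_id' (0 : ℝ)).const_mul 2).mul_const q).const_add N
  have h2 := (hasDerivAt_pow 2 (0 : ℝ)).mul_const ν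
  simpa using! h1.add h2

lemma hasDerivAt_line_ratio (hN : N ≠ 0) :
    HasDerivAt (fun t => (s + t * b) ^ 2 / (N + 2 * t * q + t ^ 2 * ν)) (ratioDeriv s b q N) 0 := by
  have h := ((hasDerivAt_line_s (s := s) (b := b)).fun_pow 2).fun_div
    (hasDerivAt_line_N (N := N) (q := q) (ν := ν)) (by simpa using hN)
  convert! h using 1
  simp [ratioDeriv]
  field_simp

lemma hasDerivAt_line_ratioDeriv (hN : N ≠ 0) :
    HasDerivAt (fun t => ratioDeriv (s + t * b) b (q + t * ν) (N + 2 * t * q + t ^ 2 * ν))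
      (ratioDeriv₂ s b q ν N) 0 := by
  have hs := hasDerivAt_line_s (s := s) (b := b)
  have hq := hasDerivAt_line_s (s := q) (b := ν)
  have hNt := hasDerivAt_line_N (N := N) (q := q) (ν := ν)
  have h1 := ((hs.const_mul 2).mul_const b).fun_div hNt (by simpa using hN)
  have h2 := (((hs.fun_pow 2).const_mul 2).fun_mul hq).fun_div (hNt.fun_pow 2) (by simpa using hN)
  convert! h1.fun_sub h2 using 1
  simp [ratioDeriv₂]
  field_simp
  ring

lemma hasDerivAt_line_term {H : ℝ → ℝ} (hH : Differentiable ℝ H) (y : ℝ) (hN : N ≠ 0) :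
    HasDerivAt (fun t => ((s + t * b) ^ 2 - y) ^ 2 *
      H ((s + t * b) ^ 2 / (N + 2 * t * q + t ^ 2 * ν))) (termDeriv H y s b q N) 0 := by
  have hs := hasDerivAt_line_s (s := s) (b := b)
  have hr := hasDerivAt_line_ratio (s := s) (b := b) (q := q) (ν := ν) hN
  have hHr := (hH _).hasDerivAt.comp (0 : ℝ) hr
  have hp := ((hs.fun_pow 2).sub_const y).fun_pow 2
  convert! hp.fun_mul hHr using 1
  simp [termDeriv]
  ring

lemma hasDerivAt_line_termDeriv {H : ℝ → ℝ} (hH : Differentiable ℝ H)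
    (hH' : Differentiable ℝ (deriv H)) (y : ℝ) (hN : N ≠ 0) :
    HasDerivAt (fun t => termDeriv H y (s + t * b) b (q + t * ν) (N + 2 * t * q + t ^ 2 * ν))
      (termDeriv₂ H y s b q ν N) 0 := by
  have hs := hasDerivAt_line_s (s := s) (b := b)
  have hr := hasDerivAt_line_ratio (s := s) (b := b) (q := q) (ν := ν) hN
  have hHr := (hH _).hasDerivAt.comp (0 : ℝ) hr
  have hHr' := (hH' _).hasDerivAt.comp (0 : ℝ) hr
  have hrr := hasDerivAt_line_ratioDeriv (s := s) (b := b) (q := q) (ν := ν) hN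
  have hp := (hs.fun_pow 2).sub_const y
  have h1 := ((((hp.const_mul 4).fun_mul hs).mul_const b).fun_mul hHr)
  have h2 := (((hp.fun_pow 2).fun_mul hHr').fun_mul hrr)
  convert! h1.fun_add h2 using 1
  simp [termDeriv₂]
  ring

end LineDerivatives

/-! ### Gradient and Hessian of the loss. -/

section LossCalculus

variable {n m : ℕ}

/-- A weighted sum of the terms of the loss function, with the weights that do not depend on `z`
abstracted away. -/
noncomputable def weightedLoss (H : ℝ → ℝ) (c : ℝ) (a : Fin m → EuclideanSpace ℝ (Fin n))
    (y w : Fin m → ℝ) (z : EuclideanSpace ℝ (Fin n)) : ℝ :=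
  c * ∑ k, (inner ℝ (a k) z ^ 2 - y k) ^ 2 * H (inner ℝ (a k) z ^ 2 / ‖z‖ ^ 2) * w k

variable {H : ℝ → ℝ} (c : ℝ) (a : Fin m → EuclideanSpace ℝ (Fin n)) (y w : Fin m → ℝ)

lemma norm_add_smul_sq (z v : EuclideanSpace ℝ (Fin n)) (t : ℝ) :
    ‖z + t • v‖ ^ 2 = ‖z‖ ^ 2 + 2 * t * inner ℝ z v + t ^ 2 * ‖v‖ ^ 2 := by
  rw [norm_add_sq_real, norm_smul, real_inner_smul_right, mul_pow, Real.norm_eq_abs, sq_abs]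
  ring

lemma inner_add_smul_right (p z v : EuclideanSpace ℝ (Fin n)) (t : ℝ) :
    inner ℝ p (z + t • v) = inner ℝ p z + t * inner ℝ p v := by
  rw [inner_add_right, real_inner_smul_right]

@[fun_prop]
lemma differentiableAt_inner_const_left (p z : EuclideanSpace ℝ (Fin n)) :
    DifferentiableAt ℝ (fun z => inner ℝ p z) z := (innerSL ℝ p).differentiableAt

lemma DifferentiableAt.div_of_ne_zero {f g : EuclideanSpace ℝ (Fin n) → ℝ}
    {z : EuclideanSpace ℝ (Fin n)} (hf : DifferentiableAt ℝ f z) (hg : DifferentiableAt ℝ g z)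
    (h0 : g z ≠ 0) : DifferentiableAt ℝ (fun p => f p / g p) z := by
  simp only [div_eq_mul_inv]
  exact hf.fun_mul ((differentiableAt_inv h0).comp z hg)

/-- The ratio `⟨p, z⟩² / ‖z‖²` is differentiable away from the origin. -/
lemma differentiableAt_inner_sq_div_norm_sq (p : EuclideanSpace ℝ (Fin n))
    {z : EuclideanSpace ℝ (Fin n)} (hz : z ≠ 0) :
    DifferentiableAt ℝ (fun z => inner ℝ p z ^ 2 / ‖z‖ ^ 2) z := by
  have hnorm : DifferentiableAt ℝ (fun z : EuclideanSpace ℝ (Fin n) => ‖z‖ ^ 2) z :=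
    (differentiable_id.norm_sq ℝ) z
  refine ((differentiableAt_inner_const_left p z).fun_pow 2).div_of_ne_zero hnorm ?_
  exact pow_ne_zero 2 (norm_ne_zero_iff.2 hz)

lemma differentiableAt_weightedLoss (hH : Differentiable ℝ H) {z : EuclideanSpace ℝ (Fin n)}
    (hz : z ≠ 0) : DifferentiableAt ℝ (weightedLoss H c a y w) z := by
  unfold weightedLoss
  refine (DifferentiableAt.fun_sum fun k _ => ?_).const_mul c
  have hr := differentiableAt_inner_sq_div_norm_sq (a k) hz
  have := (hH _).comp z hr
  refine DifferentiableAt.mul_const (DifferentiableAt.mul (by fun_prop) this) _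

lemma inner_gradient_weightedLoss (hH : Differentiable ℝ H) {z : EuclideanSpace ℝ (Fin n)}
    (hz : z ≠ 0) (v : EuclideanSpace ℝ (Fin n)) :
    inner ℝ v (gradient (weightedLoss H c a y w) z) =
      c * ∑ k, termDeriv H (y k) (inner ℝ (a k) z) (inner ℝ (a k) v) (inner ℝ z v) (‖z‖ ^ 2) *
        w k := by
  have hN : ‖z‖ ^ 2 ≠ 0 := by simpa using hz
  have hd := differentiableAt_weightedLoss c a y w hH hz
  have hline : HasDerivAt (fun t : ℝ => z + t • v) v 0 := by
    simpa using ((hasDerivAt_id (0 : ℝ)).smul_const v).const_add z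
  have h1 : HasDerivAt (fun t : ℝ => weightedLoss H c a y w (z + t • v))
      (fderiv ℝ (weightedLoss H c a y w) z v) 0 := by
    have h0 : HasFDerivAt (weightedLoss H c a y w) (fderiv ℝ (weightedLoss H c a y w) z)
        (z + (0 : ℝ) • v) := by simpa using hd.hasFDerivAt
    exact h0.comp_hasDerivAt (0 : ℝ) hline
  have h2 : HasDerivAt (fun t : ℝ => weightedLoss H c a y w (z + t • v))
      (c * ∑ k, termDeriv H (y k) (inner ℝ (a k) z) (inner ℝ (a k) v) (inner ℝ z v) (‖z‖ ^ 2) *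
        w k) 0 := by
    simp only [weightedLoss, inner_add_smul_right, norm_add_smul_sq]
    exact (HasDerivAt.fun_sum fun k _ =>
      (hasDerivAt_line_term hH (y k) hN).mul_const (w k)).const_mul c
  rw [real_inner_comm, inner_gradient_left, h1.unique h2]

/-- The vector formula serves to show that the gradient is differentiable; the estimates use only
directional derivatives. -/
lemma gradient_weightedLoss (hH : Differentiable ℝ H) {z : EuclideanSpace ℝ (Fin n)}
    (hz : z ≠ 0) : gradient (weightedLoss H c a y w) z = c • ∑ k, w k •
      ((4 * (inner ℝ (a k) z ^ 2 - y k) * inner ℝ (a k) z * H (inner ℝ (a k) z ^ 2 / ‖z‖ ^ 2) +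
        (inner ℝ (a k) z ^ 2 - y k) ^ 2 * deriv H (inner ℝ (a k) z ^ 2 / ‖z‖ ^ 2) *
          (2 * inner ℝ (a k) z / ‖z‖ ^ 2)) • a k -
        ((inner ℝ (a k) z ^ 2 - y k) ^ 2 * deriv H (inner ℝ (a k) z ^ 2 / ‖z‖ ^ 2) *
          (2 * inner ℝ (a k) z ^ 2 / (‖z‖ ^ 2) ^ 2)) • z) := by
  refine ext_inner_left ℝ fun v => ?_
  rw [inner_gradient_weightedLoss c a y w hH hz, real_inner_smul_right, inner_sum]
  congr 1
  refine Finset.sum_congr rfl fun k _ => ?_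
  rw [real_inner_smul_right, inner_sub_right, real_inner_smul_right, real_inner_smul_right,
    real_inner_comm (a k) v, real_inner_comm z v, termDeriv, ratioDeriv]
  ring

lemma differentiableAt_gradient_weightedLoss (hH : Differentiable ℝ H)
    (hH' : Differentiable ℝ (deriv H)) {z : EuclideanSpace ℝ (Fin n)} (hz : z ≠ 0) :
    DifferentiableAt ℝ (gradient (weightedLoss H c a y w)) z := by
  have hN : ‖z‖ ^ 2 ≠ 0 := by simpa using hz
  have hev : gradient (weightedLoss H c a y w) =ᶠ[nhds z] _ :=
    (eventually_ne_nhds hz).mono fun z' hz' => gradient_weightedLoss c a y w hH hz'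
  refine hev.differentiableAt_iff.2 ?_
  refine DifferentiableAt.const_smul (DifferentiableAt.fun_sum fun k _ => ?_) c
  have hnorm : DifferentiableAt ℝ (fun z : EuclideanSpace ℝ (Fin n) => ‖z‖ ^ 2) z :=
    (differentiable_id.norm_sq ℝ) z
  have hr := differentiableAt_inner_sq_div_norm_sq (a k) hz
  have h1 := (hH _).comp z hr
  have h2 := (hH' _).comp z hr
  refine DifferentiableAt.const_smul (DifferentiableAt.fun_sub ?_ ?_) (w k)
  · refine DifferentiableAt.smul_const (DifferentiableAt.fun_add
      (DifferentiableAt.mul (by fun_prop) h1) ?_) _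
    have hi : DifferentiableAt ℝ
        (fun z : EuclideanSpace ℝ (Fin n) => 2 * inner ℝ (a k) z) z := by fun_prop
    refine DifferentiableAt.mul (DifferentiableAt.mul (by fun_prop) h2) (hi.div_of_ne_zero hnorm ?_)
    exact hN
  · refine DifferentiableAt.fun_smul (𝕜' := ℝ) ?_ differentiableAt_fun_id
    have hi : DifferentiableAt ℝ
        (fun z : EuclideanSpace ℝ (Fin n) => 2 * inner ℝ (a k) z ^ 2) z := by fun_prop
    refine DifferentiableAt.mul (DifferentiableAt.mul (by fun_prop) h2)
      (hi.div_of_ne_zero (hnorm.fun_pow 2) ?_)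
    exact pow_ne_zero 2 hN

lemma hasDerivAt_inner_gradient_line {f : EuclideanSpace ℝ (Fin n) → ℝ}
    {z : EuclideanSpace ℝ (Fin n)} (hd : DifferentiableAt ℝ (gradient f) z)
    (v : EuclideanSpace ℝ (Fin n)) :
    HasDerivAt (fun t : ℝ => inner ℝ v (gradient f (z + t • v))) (hessianForm f z v) 0 := by
  have hline : HasDerivAt (fun t : ℝ => z + t • v) v 0 := by
    simpa using ((hasDerivAt_id (0 : ℝ)).smul_const v).const_add z
  have h0 : HasFDerivAt (gradient f) (fderiv ℝ (gradient f) z) (z + (0 : ℝ) • v) := by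
    simpa using hd.hasFDerivAt
  have h1 := (innerSL ℝ v).hasFDerivAt.comp_hasDerivAt (0 : ℝ) (h0.comp_hasDerivAt (0 : ℝ) hline)
  simpa [hessianForm, Function.comp_def] using h1

lemma hessianForm_weightedLoss (hH : Differentiable ℝ H) (hH' : Differentiable ℝ (deriv H))
    {z : EuclideanSpace ℝ (Fin n)} (hz : z ≠ 0) (v : EuclideanSpace ℝ (Fin n)) :
    hessianForm (weightedLoss H c a y w) z v =
      c * ∑ k, termDeriv₂ H (y k) (inner ℝ (a k) z) (inner ℝ (a k) v) (inner ℝ z v) (‖v‖ ^ 2)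
        (‖z‖ ^ 2) * w k := by
  have hN : ‖z‖ ^ 2 ≠ 0 := by simpa using hz
  have h1 := hasDerivAt_inner_gradient_line
    (differentiableAt_gradient_weightedLoss c a y w hH hH' hz) v
  have hcont : ContinuousAt (fun t : ℝ => z + t • v) 0 := by fun_prop
  have hev : ∀ᶠ t : ℝ in nhds 0, z + t • v ≠ 0 :=
    hcont.eventually_ne (by simpa using hz)
  have h2 : HasDerivAt (fun t : ℝ => inner ℝ v (gradient (weightedLoss H c a y w) (z + t • v)))
      (c * ∑ k, termDeriv₂ H (y k) (inner ℝ (a k) z) (inner ℝ (a k) v) (inner ℝ z v) (‖v‖ ^ 2)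
        (‖z‖ ^ 2) * w k) 0 := by
    refine HasDerivAt.congr_of_eventuallyEq ?_ (hev.mono fun t ht =>
      inner_gradient_weightedLoss c a y w hH ht v)
    have e : ∀ t : ℝ, inner ℝ (z + t • v) v = inner ℝ z v + t * ‖v‖ ^ 2 := fun t => by
      rw [inner_add_left, real_inner_smul_left, real_inner_self_eq_norm_sq]
    simp only [inner_add_smul_right, norm_add_smul_sq, e]
    exact (HasDerivAt.fun_sum fun k _ =>
      (hasDerivAt_line_termDeriv hH hH' (y k) hN).mul_const (w k)).const_mul c
  exact h1.unique h2

end LossCalculus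

/-! ### Second-order necessary conditions. -/

section SecondOrder

variable {n : ℕ} {f : EuclideanSpace ℝ (Fin n) → ℝ} {z v : EuclideanSpace ℝ (Fin n)}

lemma deriv_comp_line (hf : ∀ᶠ p in nhds z, DifferentiableAt ℝ f p) :
    deriv (fun t : ℝ => f (z + t • v)) =ᶠ[nhds 0]
      fun t : ℝ => inner ℝ v (gradient f (z + t • v)) := by
  have hcont : Filter.Tendsto (fun t : ℝ => z + t • v) (nhds 0) (nhds z) := by
    have : ContinuousAt (fun t : ℝ => z + t • v) 0 := by fun_prop
    simpa [ContinuousAt] using this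
  filter_upwards [hcont.eventually hf] with t ht
  have hline : HasDerivAt (fun t : ℝ => z + t • v) v t := by
    simpa using ((hasDerivAt_id t).smul_const v).const_add z
  rw [real_inner_comm, inner_gradient_left]
  exact (ht.hasFDerivAt.comp_hasDerivAt t hline).deriv

/-- The second-order necessary condition for a local minimum. -/
lemma IsLocalMin.hessianForm_nonneg (hf : ∀ᶠ p in nhds z, DifferentiableAt ℝ f p)
    (hd : DifferentiableAt ℝ (gradient f) z) (hmin : IsLocalMin f z) : 0 ≤ hessianForm f z v := by
  by_contra! hneg
  set φ : ℝ → ℝ := fun t => f (z + t • v) with hφ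
  have hcont : Filter.Tendsto (fun t : ℝ => z + t • v) (nhds 0) (nhds z) := by
    have : ContinuousAt (fun t : ℝ => z + t • v) 0 := by fun_prop
    simpa [ContinuousAt] using this
  have hφmin : IsLocalMin φ 0 := by
    filter_upwards [hcont.eventually hmin] with t ht
    simpa [hφ] using ht
  have hdd : deriv (deriv φ) 0 = hessianForm f z v := by
    rw [(deriv_comp_line (v := v) hf).deriv_eq, (hasDerivAt_inner_gradient_line hd v).deriv]
  have hφcont : ContinuousAt φ 0 := by
    have h1 : ContinuousAt f (z + (0 : ℝ) • v) := by simpa using hf.self_of_nhds.continuousAt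
    exact h1.comp (f := fun t : ℝ => z + t • v) (by fun_prop)
  -- A negative second derivative would make the local minimum a local maximum too, so `φ` would be
  -- locally constant and its second derivative zero.
  have hφmax : IsLocalMax φ 0 :=
    isLocalMax_of_deriv_deriv_neg (by rw [hdd]; exact hneg) hφmin.deriv_eq_zero hφcont
  have hconst : φ =ᶠ[nhds 0] fun _ => φ 0 := by
    filter_upwards [hφmin, hφmax] with t h1 h2 using le_antisymm h2 h1
  have : deriv (deriv φ) 0 = 0 := by
    rw [hconst.deriv.deriv_eq]; simp
  linarith

lemma gradient_fun_neg (f : EuclideanSpace ℝ (Fin n) → ℝ) :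
    gradient (fun p => -f p) = fun p => -gradient f p := by
  ext1 p
  simp [gradient]

lemma hessianForm_neg : hessianForm (fun p => -f p) z v = -hessianForm f z v := by
  rw [hessianForm, gradient_fun_neg, hessianForm]
  simp

/-- The second-order necessary condition for a local maximum. -/
lemma IsLocalMax.hessianForm_nonpos (hf : ∀ᶠ p in nhds z, DifferentiableAt ℝ f p)
    (hd : DifferentiableAt ℝ (gradient f) z) (hmax : IsLocalMax f z) : hessianForm f z v ≤ 0 := by
  have h := IsLocalMin.hessianForm_nonneg (v := v) (f := fun p => -f p)
    (hf.mono fun p hp => hp.neg) (by rw [gradient_fun_neg]; exact hd.neg) hmax.neg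
  rw [hessianForm_neg] at h
  linarith

end SecondOrder

/-! ### Comparison of cutoff weights with clipping. -/

section TruncationError

variable {m : ℕ} {H : ℝ → ℝ} {β γ M R D r : ℝ}

/-- The pointwise error made by replacing the cutoff weights by truncation. -/
lemma IsCutoff.abs_mul_sub_clip_le (hH : IsCutoff H β γ M) (hR : 0 < R) (hRβ : R ^ 2 ≤ β / 2)
    (hβγ : β ≤ γ) (hr : 1 / 2 ≤ r) (hγD : γ ≤ D) (hγr : γ * r ≤ D) (s t : ℝ) {i j : ℕ}
    (hij : i + j = 4) :
    |s ^ i * t ^ j * H (s ^ 2) * H (t ^ 2 / r) - clip R s ^ i * clip R t ^ j| ≤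
      D ^ 2 * ((if R < |s| then (1 : ℝ) else 0) + if R < |t| then (1 : ℝ) else 0) := by
  have hr0 : 0 < r := by linarith
  have hR2 : 0 < R ^ 2 := by positivity
  -- In this range `R² ≤ β / 2` and `r ≥ 1/2` make both cutoff arguments at most `β`, so nothing
  -- changes. Otherwise an indicator equals 1 and a crude bound `D²` suffices.
  by_cases h : |s| ≤ R ∧ |t| ≤ R
  · have hs : s ^ 2 ≤ R ^ 2 := by rw [← sq_abs]; gcongr; exact h.1
    have ht : t ^ 2 ≤ R ^ 2 := by rw [← sq_abs]; gcongr; exact h.2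
    rw [clip_of_abs_le h.1, clip_of_abs_le h.2, hH.eq_one _ (by linarith),
      hH.eq_one (t ^ 2 / r) (by rw [div_le_iff₀ hr0]; nlinarith)]
    simp only [mul_one, sub_self, abs_zero]
    positivity
  have hind : (1 : ℝ) ≤ (if R < |s| then (1 : ℝ) else 0) + if R < |t| then (1 : ℝ) else 0 := by
    rcases not_and_or.1 h with h | h
    · rw [if_pos (not_le.1 h)]; split_ifs <;> norm_num
    · rw [if_pos (not_le.1 h)]; split_ifs <;> norm_num
  suffices hmain : |s ^ i * t ^ j * H (s ^ 2) * H (t ^ 2 / r) - clip R s ^ i * clip R t ^ j| ≤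
      D ^ 2 from hmain.trans (le_mul_of_one_le_right (sq_nonneg D) hind)
  by_cases hz : H (s ^ 2) * H (t ^ 2 / r) = 0
  · rw [mul_assoc, hz, mul_zero, zero_sub, abs_neg]
    refine (abs_mul_clip_pow_le hR.le s t i j).trans ?_
    rw [hij, show R ^ 4 = (R ^ 2) ^ 2 by ring]
    gcongr
    linarith
  · have hs : s ^ 2 < γ := by
      by_contra! hcon
      exact hz (by rw [hH.eq_zero _ hcon, zero_mul])
    have ht : t ^ 2 < γ * r := by
      by_contra! hcon
      exact hz (by rw [hH.eq_zero (t ^ 2 / r) ((le_div_iff₀ hr0).2 hcon), mul_zero])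
    obtain ⟨θ, h0, h1, hθ⟩ := exists_mul_clip_pow_eq hR s t i j
    have hX := abs_pow_mul_pow_le (D := D) (by linarith : s ^ 2 ≤ D) (by linarith : t ^ 2 ≤ D) hij
    obtain ⟨a0, a1⟩ := hH.mem_Icc (s ^ 2)
    obtain ⟨b0, b1⟩ := hH.mem_Icc (t ^ 2 / r)
    have hw0 : 0 ≤ H (s ^ 2) * H (t ^ 2 / r) := mul_nonneg a0 b0
    have hw1 : H (s ^ 2) * H (t ^ 2 / r) ≤ 1 := mul_le_one₀ a1 b0 b1
    rw [hθ, show s ^ i * t ^ j * H (s ^ 2) * H (t ^ 2 / r) - θ * (s ^ i * t ^ j) =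
      (H (s ^ 2) * H (t ^ 2 / r) - θ) * (s ^ i * t ^ j) by ring, abs_mul]
    refine (mul_le_of_le_one_left (abs_nonneg _) (abs_le.2 ⟨by linarith, by linarith⟩)).trans hX

/-- The empirical moments weighted by the cutoffs. -/
noncomputable def weightedMoment (H : ℝ → ℝ) (r : ℝ) (s t : Fin m → ℝ) (i j : ℕ) : ℝ :=
  empMean fun k => s k ^ i * t k ^ j * H (s k ^ 2) * H (t k ^ 2 / r)

lemma IsCutoff.abs_weightedMoment_sub_le (hH : IsCutoff H β γ M) (hR : 0 < R)
    (hRβ : R ^ 2 ≤ β / 2) (hβγ : β ≤ γ) (hr : 1 / 2 ≤ r) (hγD : γ ≤ D) (hγr : γ * r ≤ D)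
    (s t : Fin m → ℝ) {i j : ℕ} (hij : i + j = 4) :
    |weightedMoment H r s t i j - empMean fun k => clip R (s k) ^ i * clip R (t k) ^ j| ≤
      D ^ 2 * ((empMean fun k => if R < |s k| then (1 : ℝ) else 0) +
        empMean fun k => if R < |t k| then (1 : ℝ) else 0) := by
  rw [weightedMoment, ← empMean_sub, ← empMean_add, ← empMean_const_mul]
  exact abs_empMean_le fun k =>
    hH.abs_mul_sub_clip_le hR hRβ hβγ hr hγD hγr (s k) (t k) hij

end TruncationError

/-! ### Bounds for single summands of the gradient and the Hessian. -/

section TermBounds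

variable {s t ρ ζ ξ D : ℝ}

lemma abs_mul_le_of_sq_le (hs : s ^ 2 ≤ D) (ht : t ^ 2 ≤ D) : |s * t| ≤ D := by
  rw [abs_le]
  constructor <;> nlinarith [sq_nonneg (s + t), sq_nonneg (s - t)]

lemma ratioDeriv_scaled (hζ : ζ ≠ 0) :
    ratioDeriv (ζ * s) (ξ * t) (ζ * ξ * ρ) (ζ ^ 2) = ξ / ζ * (2 * (s * t) - 2 * s ^ 2 * ρ) := by
  rw [ratioDeriv]
  field_simp

lemma ratioDeriv₂_scaled (hζ : ζ ≠ 0) :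
    ratioDeriv₂ (ζ * s) (ξ * t) (ζ * ξ * ρ) (ξ ^ 2) (ζ ^ 2) =
      (ξ / ζ) ^ 2 * (2 * t ^ 2 - 8 * (s * t) * ρ - 2 * s ^ 2 + 8 * s ^ 2 * ρ ^ 2) := by
  rw [ratioDeriv₂]
  field_simp

lemma abs_ratioDeriv_scaled_le (hζ : 0 < ζ) (hξ : 0 ≤ ξ) (hξζ : ξ ≤ 2 * ζ) (hρ : |ρ| ≤ 1)
    (hs : s ^ 2 ≤ D) (ht : t ^ 2 ≤ D) :
    |ratioDeriv (ζ * s) (ξ * t) (ζ * ξ * ρ) (ζ ^ 2)| ≤ 8 * D := by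
  rw [ratioDeriv_scaled hζ.ne', abs_mul, abs_of_nonneg (by positivity : 0 ≤ ξ / ζ)]
  have h1 : ξ / ζ ≤ 2 := by rwa [div_le_iff₀ hζ]
  have h2 : |2 * (s * t) - 2 * s ^ 2 * ρ| ≤ 4 * D := by
    have h3 := abs_mul_le_of_sq_le hs ht
    have h4 : |s ^ 2 * ρ| ≤ D := by
      rw [abs_mul, abs_of_nonneg (sq_nonneg s)]
      nlinarith [sq_nonneg s]
    rw [abs_le] at h3 h4 ⊢
    constructor <;> linarith [h3.1, h3.2, h4.1, h4.2]
  calc ξ / ζ * |2 * (s * t) - 2 * s ^ 2 * ρ| ≤ 2 * (4 * D) := by gcongr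
    _ = 8 * D := by ring

lemma abs_ratioDeriv₂_scaled_le (hζ : 0 < ζ) (hξ : 0 ≤ ξ) (hξζ : ξ ≤ 2 * ζ) (hρ : |ρ| ≤ 1)
    (hs : s ^ 2 ≤ D) (ht : t ^ 2 ≤ D) :
    |ratioDeriv₂ (ζ * s) (ξ * t) (ζ * ξ * ρ) (ξ ^ 2) (ζ ^ 2)| ≤ 80 * D := by
  rw [ratioDeriv₂_scaled hζ.ne', abs_mul, abs_of_nonneg (by positivity : 0 ≤ (ξ / ζ) ^ 2)]
  have h1 : ξ / ζ ≤ 2 := by rwa [div_le_iff₀ hζ]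
  have hD : 0 ≤ D := (sq_nonneg s).trans hs
  have h2 : |2 * t ^ 2 - 8 * (s * t) * ρ - 2 * s ^ 2 + 8 * s ^ 2 * ρ ^ 2| ≤ 20 * D := by
    have h3 : |s * t * ρ| ≤ D := by
      rw [abs_mul]
      exact (mul_le_of_le_one_right (abs_nonneg _) hρ).trans (abs_mul_le_of_sq_le hs ht)
    have h4 : s ^ 2 * ρ ^ 2 ≤ D := by
      have : ρ ^ 2 ≤ 1 := by rw [← sq_abs]; exact pow_le_one₀ (abs_nonneg _) hρ
      nlinarith [sq_nonneg s]
    have h5 : 0 ≤ s ^ 2 * ρ ^ 2 := by positivity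
    rw [abs_le] at h3 ⊢
    constructor <;> nlinarith [h3.1, h3.2, sq_nonneg s, sq_nonneg t]
  calc (ξ / ζ) ^ 2 * |2 * t ^ 2 - 8 * (s * t) * ρ - 2 * s ^ 2 + 8 * s ^ 2 * ρ ^ 2|
      ≤ 2 ^ 2 * (20 * D) := by gcongr
    _ = 80 * D := by ring

lemma abs_residual_scaled_le (hζ : 0 ≤ ζ) (hζξ : ζ ≤ ξ) (hs : s ^ 2 ≤ D) (ht : t ^ 2 ≤ D) :
    |(ζ * s) ^ 2 - (ξ * t) ^ 2| ≤ ξ ^ 2 * D := by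
  have h1 : (ζ * s) ^ 2 ≤ ξ ^ 2 * D := by rw [mul_pow]; gcongr
  have h2 : (ξ * t) ^ 2 ≤ ξ ^ 2 * D := by rw [mul_pow]; gcongr
  rw [abs_le]
  constructor <;> nlinarith [sq_nonneg (ζ * s), sq_nonneg (ξ * t)]

variable {H : ℝ → ℝ} {β γ M R r : ℝ}

/-- The term of the gradient in the direction of the signal, up to the contribution of the
derivative of the cutoff. -/
lemma IsCutoff.abs_termDeriv_signal_sub_le (hH : IsCutoff H β γ M) (hRβ : R ^ 2 < β)
    (hr : 0 < r) (hγD : γ ≤ D) (hγr : γ * r ≤ D) (hζ : 0 < ζ) (hζξ : ζ ≤ ξ) (hξζ : ξ ≤ 2 * ζ)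
    (hρ : |ρ| ≤ 1) :
    |termDeriv H ((ξ * t) ^ 2) (ζ * s) (ξ * t) (ζ * ξ * ρ) (ζ ^ 2) * H (t ^ 2 / r) -
      4 * (ζ ^ 3 * ξ * (s ^ 3 * t ^ 1 * H (s ^ 2) * H (t ^ 2 / r)) -
        ζ * ξ ^ 3 * (s ^ 1 * t ^ 3 * H (s ^ 2) * H (t ^ 2 / r)))| ≤
      8 * M * D ^ 3 * ξ ^ 4 * if R < |s| then (1 : ℝ) else 0 := by
  have hM := hH.nonneg
  have hD : 0 ≤ D := by
    by_contra! hcon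
    have h1 := hH.eq_zero 0 (by linarith)
    have h2 := hH.eq_one 0 (by nlinarith [sq_nonneg R])
    linarith
  have hξ : 0 ≤ ξ := hζ.le.trans hζξ
  have harg : (ζ * s) ^ 2 / ζ ^ 2 = s ^ 2 := by field_simp
  have e : termDeriv H ((ξ * t) ^ 2) (ζ * s) (ξ * t) (ζ * ξ * ρ) (ζ ^ 2) * H (t ^ 2 / r) -
      4 * (ζ ^ 3 * ξ * (s ^ 3 * t ^ 1 * H (s ^ 2) * H (t ^ 2 / r)) -
        ζ * ξ ^ 3 * (s ^ 1 * t ^ 3 * H (s ^ 2) * H (t ^ 2 / r))) =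
      ((ζ * s) ^ 2 - (ξ * t) ^ 2) ^ 2 * deriv H (s ^ 2) *
        ratioDeriv (ζ * s) (ξ * t) (ζ * ξ * ρ) (ζ ^ 2) * H (t ^ 2 / r) := by
    rw [termDeriv, harg]; ring
  rw [e]
  -- The error survives only for `β < s² < γ` and `t² < γ r`: there all factors are bounded in terms
  -- of `D`, and `|s| > R`.
  by_cases hz : deriv H (s ^ 2) * H (t ^ 2 / r) = 0
  · have : ((ζ * s) ^ 2 - (ξ * t) ^ 2) ^ 2 * deriv H (s ^ 2) *
        ratioDeriv (ζ * s) (ξ * t) (ζ * ξ * ρ) (ζ ^ 2) * H (t ^ 2 / r) = 0 := by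
      rcases mul_eq_zero.1 hz with h | h <;> rw [h] <;> ring
    rw [this, abs_zero]
    positivity
  have hs : s ^ 2 < γ := by
    by_contra! hcon
    exact hz (by rw [hH.deriv_eq_zero_of_ge hcon, zero_mul])
  have hs' : β < s ^ 2 := by
    by_contra! hcon
    exact hz (by rw [hH.deriv_eq_zero_of_le hcon, zero_mul])
  have ht : t ^ 2 < γ * r := by
    by_contra! hcon
    exact hz (by rw [hH.eq_zero (t ^ 2 / r) ((le_div_iff₀ hr).2 hcon), mul_zero])
  rw [if_pos (lt_of_pow_lt_pow_left₀ 2 (abs_nonneg s) (by rw [sq_abs]; linarith)), mul_one]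
  have hsD : s ^ 2 ≤ D := by linarith
  have htD : t ^ 2 ≤ D := by linarith
  rw [abs_mul, abs_mul, abs_mul, abs_pow]
  have hw : |H (t ^ 2 / r)| ≤ 1 := abs_le.2 ⟨by linarith [(hH.mem_Icc (t ^ 2 / r)).1],
    (hH.mem_Icc _).2⟩
  calc _ ≤ (ξ ^ 2 * D) ^ 2 * M * (8 * D) * 1 := by
        gcongr
        · exact abs_residual_scaled_le hζ.le hζξ hsD htD
        · exact hH.abs_deriv_le _
        · exact abs_ratioDeriv_scaled_le hζ hξ hξζ hρ hsD htD
    _ = _ := by ring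

/-- The term of the Hessian in the direction of the signal, up to the contribution of the
derivatives of the cutoff. -/
lemma IsCutoff.abs_termDeriv₂_signal_sub_le (hH : IsCutoff H β γ M)
    (hRβ : R ^ 2 < β) (hr : 0 < r) (hD1 : 1 ≤ D) (hγD : γ ≤ D) (hγr : γ * r ≤ D) (hζ : 0 < ζ)
    (hζξ : ζ ≤ ξ) (hξζ : ξ ≤ 2 * ζ) (hρ : |ρ| ≤ 1) :
    |termDeriv₂ H ((ξ * t) ^ 2) (ζ * s) (ξ * t) (ζ * ξ * ρ) (ξ ^ 2) (ζ ^ 2) * H (t ^ 2 / r) -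
      (12 * ζ ^ 2 * ξ ^ 2 * (s ^ 2 * t ^ 2 * H (s ^ 2) * H (t ^ 2 / r)) -
        4 * ξ ^ 4 * (s ^ 0 * t ^ 4 * H (s ^ 2) * H (t ^ 2 / r)))| ≤
      208 * M * D ^ 4 * ξ ^ 4 * if R < |s| then (1 : ℝ) else 0 := by
  have hM := hH.nonneg
  have hξ : 0 ≤ ξ := hζ.le.trans hζξ
  have harg : (ζ * s) ^ 2 / ζ ^ 2 = s ^ 2 := by field_simp
  set d := ratioDeriv (ζ * s) (ξ * t) (ζ * ξ * ρ) (ζ ^ 2) with hd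
  set d₂ := ratioDeriv₂ (ζ * s) (ξ * t) (ζ * ξ * ρ) (ξ ^ 2) (ζ ^ 2) with hd₂
  set p := (ζ * s) ^ 2 - (ξ * t) ^ 2 with hp
  have e : termDeriv₂ H ((ξ * t) ^ 2) (ζ * s) (ξ * t) (ζ * ξ * ρ) (ξ ^ 2) (ζ ^ 2) *
        H (t ^ 2 / r) -
      (12 * ζ ^ 2 * ξ ^ 2 * (s ^ 2 * t ^ 2 * H (s ^ 2) * H (t ^ 2 / r)) -
        4 * ξ ^ 4 * (s ^ 0 * t ^ 4 * H (s ^ 2) * H (t ^ 2 / r))) =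
      (8 * p * (ζ * ξ) * (s * t) * deriv H (s ^ 2) * d +
        p ^ 2 * (deriv (deriv H) (s ^ 2) * d ^ 2 + deriv H (s ^ 2) * d₂)) * H (t ^ 2 / r) := by
    rw [termDeriv₂, harg, ← hd, ← hd₂, ← hp, hp]; ring
  rw [e]
  by_cases hs : s ^ 2 ≤ β ∨ γ ≤ s ^ 2
  · have h1 : deriv H (s ^ 2) = 0 := hs.elim hH.deriv_eq_zero_of_le hH.deriv_eq_zero_of_ge
    have h2 : deriv (deriv H) (s ^ 2) = 0 :=
      hs.elim hH.deriv_deriv_eq_zero_of_le hH.deriv_deriv_eq_zero_of_ge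
    rw [h1, h2]
    simp only [mul_zero, zero_mul, add_zero, abs_zero]
    positivity
  by_cases hw0 : H (t ^ 2 / r) = 0
  · rw [hw0, mul_zero, abs_zero]
    positivity
  push Not at hs
  have ht : t ^ 2 < γ * r := by
    by_contra! hcon
    exact hw0 (hH.eq_zero (t ^ 2 / r) ((le_div_iff₀ hr).2 hcon))
  rw [if_pos (lt_of_pow_lt_pow_left₀ 2 (abs_nonneg s) (by rw [sq_abs]; linarith)), mul_one]
  have hsD : s ^ 2 ≤ D := by linarith
  have htD : t ^ 2 ≤ D := by linarith
  have hw : |H (t ^ 2 / r)| ≤ 1 := abs_le.2 ⟨by linarith [(hH.mem_Icc (t ^ 2 / r)).1],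
    (hH.mem_Icc _).2⟩
  have bp : |p| ≤ ξ ^ 2 * D := abs_residual_scaled_le hζ.le hζξ hsD htD
  have bd : |d| ≤ 8 * D := abs_ratioDeriv_scaled_le hζ hξ hξζ hρ hsD htD
  have bd₂ : |d₂| ≤ 80 * D := abs_ratioDeriv₂_scaled_le hζ hξ hξζ hρ hsD htD
  have bst : |s * t| ≤ D := abs_mul_le_of_sq_le hsD htD
  have bz : |ζ * ξ| ≤ ξ ^ 2 := by
    rw [abs_of_nonneg (by positivity), sq]; gcongr
  have b1 := hH.abs_deriv_le (s ^ 2)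
  have b2 := hH.abs_deriv_deriv_le (s ^ 2)
  calc _ ≤ |8 * p * (ζ * ξ) * (s * t) * deriv H (s ^ 2) * d +
        p ^ 2 * (deriv (deriv H) (s ^ 2) * d ^ 2 + deriv H (s ^ 2) * d₂)| := by
        rw [abs_mul]; exact mul_le_of_le_one_right (abs_nonneg _) hw
    _ ≤ 8 * |p| * |ζ * ξ| * |s * t| * |deriv H (s ^ 2)| * |d| +
        |p| ^ 2 * (|deriv (deriv H) (s ^ 2)| * |d| ^ 2 + |deriv H (s ^ 2)| * |d₂|) := by
        refine (abs_add_le _ _).trans (add_le_add (le_of_eq ?_) ?_)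
        · simp only [abs_mul]; norm_num
        · rw [abs_mul, abs_pow]
          gcongr
          refine (abs_add_le _ _).trans (le_of_eq ?_)
          rw [abs_mul, abs_mul, abs_pow]
    _ ≤ 8 * (ξ ^ 2 * D) * ξ ^ 2 * D * M * (8 * D) +
        (ξ ^ 2 * D) ^ 2 * (M * (8 * D) ^ 2 + M * (80 * D)) := by gcongr
    _ = M * ξ ^ 4 * (144 * D ^ 3 + 64 * D ^ 4) := by ring
    _ ≤ M * ξ ^ 4 * (208 * D ^ 4) := by
        have : D ^ 3 ≤ D ^ 4 := pow_le_pow_right₀ hD1 (by norm_num)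
        gcongr
        linarith
    _ = 208 * M * D ^ 4 * ξ ^ 4 := by ring

/-- The cutoff argument is invariant under scaling of `z`, so its radial derivative vanishes and no
error term arises. -/
lemma termDeriv_radial (hζ : ζ ≠ 0) (w : ℝ) :
    termDeriv H ((ξ * t) ^ 2) (ζ * s) (ζ * s) (ζ ^ 2) (ζ ^ 2) * w =
      4 * (ζ ^ 4 * (s ^ 4 * t ^ 0 * H (s ^ 2) * w) -
        ζ ^ 2 * ξ ^ 2 * (s ^ 2 * t ^ 2 * H (s ^ 2) * w)) := by
  have harg : (ζ * s) ^ 2 / ζ ^ 2 = s ^ 2 := by field_simp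
  have h0 : ratioDeriv (ζ * s) (ζ * s) (ζ ^ 2) (ζ ^ 2) = 0 := by
    rw [ratioDeriv]; field_simp; ring
  rw [termDeriv, harg, h0]; ring

lemma termDeriv₂_radial (hζ : ζ ≠ 0) (w : ℝ) :
    termDeriv₂ H ((ξ * t) ^ 2) (ζ * s) (ζ * s) (ζ ^ 2) (ζ ^ 2) (ζ ^ 2) * w =
      12 * ζ ^ 4 * (s ^ 4 * t ^ 0 * H (s ^ 2) * w) -
        4 * ζ ^ 2 * ξ ^ 2 * (s ^ 2 * t ^ 2 * H (s ^ 2) * w) := by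
  have harg : (ζ * s) ^ 2 / ζ ^ 2 = s ^ 2 := by field_simp
  have h0 : ratioDeriv (ζ * s) (ζ * s) (ζ ^ 2) (ζ ^ 2) = 0 := by
    rw [ratioDeriv]; field_simp; ring
  have h1 : ratioDeriv₂ (ζ * s) (ζ * s) (ζ ^ 2) (ζ ^ 2) (ζ ^ 2) = 0 := by
    rw [ratioDeriv₂]; field_simp; ring
  rw [termDeriv₂, harg, h0, h1]; ring

end TermBounds

/-! ### The landscape of the expected loss and its perturbations. -/

/-- The gradient and the Hessian of `f` in the directions of `z` and `x` are, up to errors of size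
`η ‖x‖⁴`, those of the expected intensity loss. -/
structure IsNearPopulationLoss {n : ℕ} (f : EuclideanSpace ℝ (Fin n) → ℝ)
    (x : EuclideanSpace ℝ (Fin n)) (η : ℝ) : Prop where
  differentiableAt : ∀ z, z ≠ 0 → DifferentiableAt ℝ f z
  differentiableAt_gradient : ∀ z, z ≠ 0 → DifferentiableAt ℝ (gradient f) z
  gradient_radial : ∀ z, z ≠ 0 → ‖z‖ ≤ ‖x‖ → ‖x‖ ≤ 2 * ‖z‖ →
    |inner ℝ z (gradient f z) - 2 * (3 * ‖z‖ ^ 4 - ‖z‖ ^ 2 * ‖x‖ ^ 2 - 2 * inner ℝ z x ^ 2)| ≤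
      4 * η * ‖x‖ ^ 4
  gradient_signal : ∀ z, z ≠ 0 → ‖z‖ ≤ ‖x‖ → ‖x‖ ≤ 2 * ‖z‖ →
    |inner ℝ x (gradient f z) - 6 * inner ℝ z x * (‖z‖ ^ 2 - ‖x‖ ^ 2)| ≤ 5 * η * ‖x‖ ^ 4
  hessian_signal : ∀ z, z ≠ 0 → ‖z‖ ≤ ‖x‖ → ‖x‖ ≤ 2 * ‖z‖ →
    |hessianForm f z x - (6 * ‖z‖ ^ 2 * ‖x‖ ^ 2 + 12 * inner ℝ z x ^ 2 - 6 * ‖x‖ ^ 4)| ≤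
      9 * η * ‖x‖ ^ 4
  hessian_radial : ∀ z, z ≠ 0 → ‖z‖ ≤ ‖x‖ → ‖x‖ ≤ 2 * ‖z‖ →
    |hessianForm f z z - (18 * ‖z‖ ^ 4 - 2 * ‖z‖ ^ 2 * ‖x‖ ^ 2 - 4 * inner ℝ z x ^ 2)| ≤
      8 * η * ‖x‖ ^ 4

namespace IsNearPopulationLoss

variable {n : ℕ} {f : EuclideanSpace ℝ (Fin n) → ℝ} {x z : EuclideanSpace ℝ (Fin n)} {η δ : ℝ}

/-- Critical points in the region lie in the subregion. -/
lemma mem_subregion (hf : IsNearPopulationLoss f x η) (hx : x ≠ 0) (hδ : 0 < δ)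
    (hδ' : δ ≤ 1 / 100) (hη : η ≤ δ / 1000) (hz : z ∈ regionTwoA δ x) (hcrit : gradient f z = 0) :
    z ∈ subregionTwoA δ x := by
  obtain ⟨h1, h2, -⟩ := hz
  have hξ : 0 < ‖x‖ := norm_pos_iff.2 hx
  have hξ2 : 0 < ‖x‖ ^ 2 := by positivity
  refine ⟨h1, ?_⟩
  rw [lt_div_iff₀ hξ2] at h1
  rw [div_lt_iff₀ hξ2] at h2 ⊢
  have hz0 : z ≠ 0 := by
    rintro rfl
    rw [norm_zero] at h1
    nlinarith
  -- The bounds follow from `99/100 ≤ 1` and `1/3 - δ ≥ 1/4`.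
  have hle : ‖z‖ ≤ ‖x‖ := le_of_sq_le_sq (by nlinarith) hξ.le
  have hle' : ‖x‖ ≤ 2 * ‖z‖ := le_of_sq_le_sq (by nlinarith) (by positivity)
  have g1 := hf.gradient_radial z hz0 hle hle'
  have g2 := hf.gradient_signal z hz0 hle hle'
  rw [hcrit, inner_zero_right, zero_sub, abs_neg] at g1 g2
  rw [show ‖z‖ ^ 4 = (‖z‖ ^ 2) ^ 2 by ring, show ‖x‖ ^ 4 = (‖x‖ ^ 2) ^ 2 by ring] at g1
  rw [show ‖x‖ ^ 4 = (‖x‖ ^ 2) ^ 2 by ring] at g2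
  set X : ℝ := inner ℝ z x
  set p := ‖z‖ ^ 2
  set q := ‖x‖ ^ 2
  -- Since `q - p ≥ q / 100`, the signal equation gives `|X| ≤ δ q / 12`.
  have hX : |X| ≤ 1 / 10 * δ * q := by
    rw [abs_mul, abs_mul, abs_of_pos (by norm_num : (0 : ℝ) < 6), abs_of_neg (by linarith : p - q < 0)] at g2
    have h3 : 6 * |X| * (1 / 100 * q) ≤ 5 * (δ / 1000) * q ^ 2 := by
      have : 6 * |X| * (1 / 100 * q) ≤ 6 * |X| * -(p - q) := by gcongr; linarith
      nlinarith [sq_nonneg q]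
    by_contra! hcon
    nlinarith
  have hX2 : X ^ 2 ≤ (1 / 10 * δ * q) ^ 2 := by rw [← sq_abs]; gcongr
  have hX3 : X ^ 2 ≤ 1 / 10000 * δ * q ^ 2 := by nlinarith [mul_pos hδ (pow_pos hξ2 2)]
  refine ⟨?_, by nlinarith⟩
  have g3 := (abs_le.1 g1).2
  by_contra! hcon
  have h4 : 4 * η * q ^ 2 ≤ 4 * (δ / 1000) * q ^ 2 := by gcongr
  have h5 : 3 * δ * q ≤ 3 * p - q := by linarith
  -- If `p ≥ (1/3 + δ) q`, then `2 p (3 p - q) ≥ 2 δ q²`, while the radial equation bounds it by `4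
  -- η q² + 4 X²`, which is far smaller.
  have h6 : 1 / 3 * q * (3 * δ * q) ≤ p * (3 * p - q) := by
    refine mul_le_mul (by nlinarith) h5 (by positivity) (by nlinarith)
  nlinarith [mul_pos hδ (pow_pos hξ2 2)]

/-- The Hessian bounds on the subregion. -/
lemma hessian_bounds (hf : IsNearPopulationLoss f x η) (hx : x ≠ 0)
    (hδ' : δ ≤ 1 / 100) (hη : η ≤ 1 / 1000) (hz : z ∈ subregionTwoA δ x) :
    hessianForm f z x ≤ -3 * ‖x‖ ^ 4 ∧ ‖x‖ ^ 4 ≤ hessianForm f z z := by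
  obtain ⟨h1, h2, hX⟩ := hz
  have hξ : 0 < ‖x‖ := norm_pos_iff.2 hx
  have hξ2 : 0 < ‖x‖ ^ 2 := by positivity
  rw [lt_div_iff₀ hξ2] at h1
  rw [div_lt_iff₀ hξ2] at h2
  have hz0 : z ≠ 0 := by
    rintro rfl
    rw [norm_zero] at h1
    nlinarith
  have hle : ‖z‖ ≤ ‖x‖ := le_of_sq_le_sq (by nlinarith) hξ.le
  have hle' : ‖x‖ ≤ 2 * ‖z‖ := le_of_sq_le_sq (by nlinarith) (by positivity)
  have g1 := (abs_le.1 (hf.hessian_signal z hz0 hle hle')).2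
  have g2 := (abs_le.1 (hf.hessian_radial z hz0 hle hle')).1
  rw [show ‖x‖ ^ 4 = (‖x‖ ^ 2) ^ 2 by ring] at g1 g2 ⊢
  rw [show ‖z‖ ^ 4 = (‖z‖ ^ 2) ^ 2 by ring] at g2
  set X : ℝ := inner ℝ z x
  set p := ‖z‖ ^ 2
  set q := ‖x‖ ^ 2
  have hX2 : X ^ 2 ≤ (1 / 100 * q) ^ 2 := by
    rw [← sq_abs]
    have : |X| ≤ 1 / 100 * q := by nlinarith
    gcongr
  have hq2 : 0 < q ^ 2 := by positivity
  have h3 : η * q ^ 2 ≤ 1 / 1000 * q ^ 2 := by gcongr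
  -- On this interval the two forms are at worst about `-3.9 q²` and `1.2 q²`, errors included.
  have hp1 : 97 / 300 * q ≤ p := by nlinarith
  have hp2 : p ≤ 103 / 300 * q := by nlinarith
  constructor
  · nlinarith
  · have : (97 / 300 * q) * (18 * (97 / 300 * q) - 2 * q) ≤ p * (18 * p - 2 * q) := by
      refine mul_le_mul hp1 (by linarith) (by linarith) (by linarith)
    nlinarith

/-- The landscape on the region: location of the critical points, curvature, and ridability. -/
lemma landscape (hf : IsNearPopulationLoss f x η) (hx : x ≠ 0) (hδ : 0 < δ)
    (hδ' : δ ≤ 1 / 100) (hη : η ≤ δ / 1000) :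
    (∀ z ∈ regionTwoA δ x, gradient f z = 0 → z ∈ subregionTwoA δ x) ∧
    (∀ z ∈ subregionTwoA δ x, hessianForm f z x ≤ -3 * ‖x‖ ^ 4 ∧ ‖x‖ ^ 4 ≤ hessianForm f z z) ∧
    (∀ z ∈ regionTwoA δ x, gradient f z = 0 → IsRidableSaddle f z) := by
  have hsub := fun z hz hc => hf.mem_subregion (z := z) hx hδ hδ' hη hz hc
  have hhess := fun z hz => hf.hessian_bounds (z := z) hx hδ' (by linarith) hz
  refine ⟨hsub, hhess, fun z hz hc => ?_⟩
  obtain ⟨hneg, hpos⟩ := hhess z (hsub z hz hc)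
  have hx4 : 0 < ‖x‖ ^ 4 := by have := norm_pos_iff.2 hx; positivity
  have hz0 : z ≠ 0 := by
    rintro rfl
    have h1 := hz.1
    rw [norm_zero] at h1
    norm_num at h1
    linarith
  have hev : ∀ᶠ p in nhds z, DifferentiableAt ℝ f p :=
    (eventually_ne_nhds hz0).mono fun p hp => hf.differentiableAt p hp
  have hd := hf.differentiableAt_gradient z hz0
  refine ⟨hc ▸ (hf.differentiableAt z hz0).hasGradientAt, fun hmin => ?_, fun hmax => ?_,
    ⟨x, by linarith⟩, ⟨z, by linarith⟩⟩
  · linarith [IsLocalMin.hessianForm_nonneg (v := x) hev hd hmin]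
  · linarith [IsLocalMax.hessianForm_nonpos (v := z) hev hd hmax]

end IsNearPopulationLoss

/-! ### From the good event to the theorem. -/

lemma half_inv_mul_sum {m : ℕ} (F : Fin m → ℝ) : 1 / (2 * (m : ℝ)) * ∑ k, F k = 1 / 2 * empMean F := by
  rw [empMean, one_div, one_div, mul_inv]; ring

lemma abs_mul_sub_mul_le {c S P η q : ℝ} (hc : 0 ≤ c) (hcq : c ≤ q) (h : |S - P| ≤ η) :
    |c * S - c * P| ≤ η * q := by
  rw [← mul_sub, abs_mul, abs_of_nonneg hc, mul_comm η]
  exact mul_le_mul hcq h (abs_nonneg _) (hc.trans hcq)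

/-- On a sample whose truncated moments are close to the Gaussian ones, the loss is close to the
expected intensity loss. -/
lemma isNearPopulationLoss_weightedLoss {n m : ℕ} {H : ℝ → ℝ} {β γ M R D A η r : ℝ}
    (hH : IsCutoff H β γ M) (hR : 0 < R) (hRβ : R ^ 2 = β / 2) (hβγ : β ≤ γ) (hD1 : 1 ≤ D)
    (hγD : γ ≤ D) (hγr : γ * r ≤ D) (hr : 1 / 2 ≤ r) (hη : 0 ≤ η)
    (hη₁ : A / R ^ 2 + D ^ 2 * (A / R ^ 12 + A / R ^ 12) ≤ η)
    (hη₂ : 104 * M * D ^ 4 * (A / R ^ 12) ≤ η)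
    (a : Fin m → EuclideanSpace ℝ (Fin n)) {x : EuclideanSpace ℝ (Fin n)} (hx : x ≠ 0)
    (hmom : ∀ v : EuclideanSpace ℝ (Fin n), ‖v‖ = 1 → ∀ i j : ℕ, i + j = 4 →
      |(empMean fun k => clip R (inner ℝ (a k) v) ^ i * clip R (inner ℝ (a k) (‖x‖⁻¹ • x)) ^ j) -
        ∫ p, inner ℝ p v ^ i * inner ℝ p (‖x‖⁻¹ • x) ^ j
          ∂stdGaussian (EuclideanSpace ℝ (Fin n))| ≤ A / R ^ 2)
    (htail : ∀ v : EuclideanSpace ℝ (Fin n), ‖v‖ = 1 →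
      (empMean fun k => if R < |inner ℝ (a k) v| then (1 : ℝ) else 0) ≤ A / R ^ 12) :
    IsNearPopulationLoss (weightedLoss H (1 / (2 * (m : ℝ))) a (fun k => inner ℝ (a k) x ^ 2)
      fun k => H (inner ℝ (a k) (‖x‖⁻¹ • x) ^ 2 / r)) x η := by
  have hM := hH.nonneg
  have hξ : 0 < ‖x‖ := norm_pos_iff.2 hx
  have hr0 : 0 < r := by linarith
  have hβ : R ^ 2 < β := by nlinarith [pow_pos hR 2]
  set u := ‖x‖⁻¹ • x with hu
  have hu1 : ‖u‖ = 1 := by rw [hu, norm_smul]; simp [hξ.ne']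
  have hxu : x = ‖x‖ • u := by rw [hu, smul_smul, mul_inv_cancel₀ hξ.ne', one_smul]
  have key : ∀ z : EuclideanSpace ℝ (Fin n), z ≠ 0 → ∃ v : EuclideanSpace ℝ (Fin n), ‖v‖ = 1 ∧
      z = ‖z‖ • v := fun z hz => by
    have hζ := norm_pos_iff.2 hz
    exact ⟨‖z‖⁻¹ • z, by rw [norm_smul]; simp [hζ.ne'],
      by rw [smul_smul, mul_inv_cancel₀ hζ.ne', one_smul]⟩
  have hS : ∀ v : EuclideanSpace ℝ (Fin n), ‖v‖ = 1 → ∀ i j : ℕ, i + j = 4 →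
      |weightedMoment H r (fun k => inner ℝ (a k) v) (fun k => inner ℝ (a k) u) i j -
        ∫ p, inner ℝ p v ^ i * inner ℝ p u ^ j ∂stdGaussian (EuclideanSpace ℝ (Fin n))| ≤ η := by
    intro v hv i j hij
    have h1 := hH.abs_weightedMoment_sub_le hR hRβ.le hβγ hr hγD hγr
      (fun k => inner ℝ (a k) v) (fun k => inner ℝ (a k) u) hij
    have h2 : D ^ 2 * ((empMean fun k => if R < |inner ℝ (a k) v| then (1 : ℝ) else 0) +
        empMean fun k => if R < |inner ℝ (a k) u| then (1 : ℝ) else 0) ≤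
        D ^ 2 * (A / R ^ 12 + A / R ^ 12) := by
      gcongr
      · exact htail v hv
      · exact htail u hu1
    exact (abs_sub_le _ _ _).trans ((add_le_add (h1.trans h2) (hmom v hv i j hij)).trans
      (by linarith))
  have hx_inner : ∀ k, inner ℝ (a k) x = ‖x‖ * inner ℝ (a k) u := fun k => by
    conv_lhs => rw [hxu, real_inner_smul_right]
  have hsetup : ∀ z : EuclideanSpace ℝ (Fin n), z ≠ 0 → ∃ (v : EuclideanSpace ℝ (Fin n)),
      ‖v‖ = 1 ∧ (∀ k, inner ℝ (a k) z = ‖z‖ * inner ℝ (a k) v) ∧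
      inner ℝ z x = ‖z‖ * ‖x‖ * inner ℝ v u ∧ |inner ℝ v u| ≤ 1 ∧
      (empMean fun k => if R < |inner ℝ (a k) v| then (1 : ℝ) else 0) ≤ A / R ^ 12 ∧
      |weightedMoment H r (fun k => inner ℝ (a k) v) (fun k => inner ℝ (a k) u) 4 0 - 3| ≤ η ∧
      |weightedMoment H r (fun k => inner ℝ (a k) v) (fun k => inner ℝ (a k) u) 3 1 -
        3 * inner ℝ v u| ≤ η ∧
      |weightedMoment H r (fun k => inner ℝ (a k) v) (fun k => inner ℝ (a k) u) 2 2 -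
        (1 + 2 * inner ℝ v u ^ 2)| ≤ η ∧
      |weightedMoment H r (fun k => inner ℝ (a k) v) (fun k => inner ℝ (a k) u) 1 3 -
        3 * inner ℝ v u| ≤ η ∧
      |weightedMoment H r (fun k => inner ℝ (a k) v) (fun k => inner ℝ (a k) u) 0 4 - 3| ≤ η := by
    intro z hz
    obtain ⟨v, hv, hzv⟩ := key z hz
    obtain ⟨i40, i31, i22, i13, i04⟩ := integral_inner_quartic v u hv hu1
    refine ⟨v, hv, fun k => ?_, ?_, ?_, htail v hv, ?_, ?_, ?_, ?_, ?_⟩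
    · conv_lhs => rw [hzv, real_inner_smul_right]
    · conv_lhs => rw [hzv, hxu, real_inner_smul_left, real_inner_smul_right]
      ring
    · simpa [hv, hu1] using abs_real_inner_le_norm v u
    · rw [← i40]; exact hS v hv 4 0 rfl
    · rw [← i31]; exact hS v hv 3 1 rfl
    · rw [← i22]; exact hS v hv 2 2 rfl
    · rw [← i13]; exact hS v hv 1 3 rfl
    · rw [← i04]; exact hS v hv 0 4 rfl
  -- Half the sum of the moment coefficients, plus the cutoff error where present, gives the
  -- factors: `(4 + 4) / 2`, `(4 + 4 + 1) / 2 ≤ 5`, `(12 + 4 + 2) / 2` and `(12 + 4) / 2`.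
  refine ⟨fun z hz => differentiableAt_weightedLoss _ _ _ _ hH.differentiable hz,
    fun z hz => differentiableAt_gradient_weightedLoss _ _ _ _ hH.differentiable
      hH.differentiable_deriv hz, fun z hz h1 h2 => ?_, fun z hz h1 h2 => ?_, fun z hz h1 h2 => ?_,
    fun z hz h1 h2 => ?_⟩
  · obtain ⟨v, hv, hzv, hX, hρ, ht, m40, -, m22, -, -⟩ := hsetup z hz
    have hζ := norm_pos_iff.2 hz
    rw [inner_gradient_weightedLoss _ _ _ _ hH.differentiable hz, half_inv_mul_sum]
    simp only [hzv, hx_inner, real_inner_self_eq_norm_sq, termDeriv_radial hζ.ne']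
    rw [empMean_const_mul, empMean_sub, empMean_const_mul, empMean_const_mul, hX]
    change |1 / 2 * (4 * (‖z‖ ^ 4 * weightedMoment H r (fun k => inner ℝ (a k) v)
      (fun k => inner ℝ (a k) u) 4 0 - ‖z‖ ^ 2 * ‖x‖ ^ 2 * weightedMoment H r
      (fun k => inner ℝ (a k) v) (fun k => inner ℝ (a k) u) 2 2)) - _| ≤ _
    have e1 := abs_mul_sub_mul_le (c := ‖z‖ ^ 4) (q := ‖x‖ ^ 4) (by positivity) (by gcongr) m40
    have e2 := abs_mul_sub_mul_le (c := ‖z‖ ^ 2 * ‖x‖ ^ 2) (q := ‖x‖ ^ 4) (by positivity)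
      (by rw [show ‖x‖ ^ 4 = ‖x‖ ^ 2 * ‖x‖ ^ 2 by ring]; gcongr) m22
    rw [abs_le] at *
    constructor <;> linarith [e1.1, e1.2, e2.1, e2.2]
  · obtain ⟨v, hv, hzv, hX, hρ, ht, -, m31, -, m13, -⟩ := hsetup z hz
    have hζ := norm_pos_iff.2 hz
    rw [inner_gradient_weightedLoss _ _ _ _ hH.differentiable hz, half_inv_mul_sum]
    simp only [hzv, hx_inner, hX]
    have herr := (abs_empMean_le fun k => hH.abs_termDeriv_signal_sub_le (s := inner ℝ (a k) v)
      (t := inner ℝ (a k) u) hβ hr0 hγD hγr hζ h1 h2 hρ)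
    rw [empMean_sub, empMean_const_mul, empMean_sub, empMean_const_mul, empMean_const_mul,
      empMean_const_mul] at herr
    change |_ - 4 * (‖z‖ ^ 3 * ‖x‖ * weightedMoment H r (fun k => inner ℝ (a k) v)
      (fun k => inner ℝ (a k) u) 3 1 - ‖z‖ * ‖x‖ ^ 3 * weightedMoment H r
      (fun k => inner ℝ (a k) v) (fun k => inner ℝ (a k) u) 1 3)| ≤ _ at herr
    have e0 : 8 * M * D ^ 3 * ‖x‖ ^ 4 * (empMean fun k => if R < |inner ℝ (a k) v| then (1 : ℝ)
        else 0) ≤ η * ‖x‖ ^ 4 := by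
      have hτ : 0 ≤ empMean fun k => if R < |inner ℝ (a k) v| then (1 : ℝ) else 0 :=
        empMean_nonneg fun k => by positivity
      have hD3 : D ^ 3 ≤ D ^ 4 := pow_le_pow_right₀ hD1 (by norm_num)
      calc _ ≤ 104 * M * D ^ 4 * ‖x‖ ^ 4 * (A / R ^ 12) := by
            gcongr
            norm_num
        _ = 104 * M * D ^ 4 * (A / R ^ 12) * ‖x‖ ^ 4 := by ring
        _ ≤ η * ‖x‖ ^ 4 := by gcongr
    have e1 := abs_mul_sub_mul_le (c := ‖z‖ ^ 3 * ‖x‖) (q := ‖x‖ ^ 4) (by positivity)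
      (by rw [show ‖x‖ ^ 4 = ‖x‖ ^ 3 * ‖x‖ by ring]; gcongr) m31
    have e2 := abs_mul_sub_mul_le (c := ‖z‖ * ‖x‖ ^ 3) (q := ‖x‖ ^ 4) (by positivity)
      (by rw [show ‖x‖ ^ 4 = ‖x‖ * ‖x‖ ^ 3 by ring]; gcongr) m13
    have hq : 0 ≤ η * ‖x‖ ^ 4 := by positivity
    have herr' := herr.trans e0
    rw [abs_le] at *
    constructor <;> linarith [e1.1, e1.2, e2.1, e2.2, herr'.1, herr'.2]
  · obtain ⟨v, hv, hzv, hX, hρ, ht, -, -, m22, -, m04⟩ := hsetup z hz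
    have hζ := norm_pos_iff.2 hz
    rw [hessianForm_weightedLoss _ _ _ _ hH.differentiable hH.differentiable_deriv hz,
      half_inv_mul_sum]
    simp only [hzv, hx_inner, hX]
    have herr := (abs_empMean_le fun k => hH.abs_termDeriv₂_signal_sub_le (s := inner ℝ (a k) v)
      (t := inner ℝ (a k) u) hβ hr0 hD1 hγD hγr hζ h1 h2 hρ)
    rw [empMean_sub, empMean_sub, empMean_const_mul, empMean_const_mul, empMean_const_mul] at herr
    change |_ - (12 * ‖z‖ ^ 2 * ‖x‖ ^ 2 * weightedMoment H r (fun k => inner ℝ (a k) v)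
      (fun k => inner ℝ (a k) u) 2 2 - 4 * ‖x‖ ^ 4 * weightedMoment H r
      (fun k => inner ℝ (a k) v) (fun k => inner ℝ (a k) u) 0 4)| ≤ _ at herr
    have e0 : 208 * M * D ^ 4 * ‖x‖ ^ 4 * (empMean fun k => if R < |inner ℝ (a k) v| then (1 : ℝ)
        else 0) ≤ 2 * η * ‖x‖ ^ 4 := by
      calc _ ≤ 208 * M * D ^ 4 * ‖x‖ ^ 4 * (A / R ^ 12) := by gcongr
        _ = 2 * (104 * M * D ^ 4 * (A / R ^ 12)) * ‖x‖ ^ 4 := by ring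
        _ ≤ 2 * η * ‖x‖ ^ 4 := by gcongr
    have e1 := abs_mul_sub_mul_le (c := ‖z‖ ^ 2 * ‖x‖ ^ 2) (q := ‖x‖ ^ 4) (by positivity)
      (by rw [show ‖x‖ ^ 4 = ‖x‖ ^ 2 * ‖x‖ ^ 2 by ring]; gcongr) m22
    have e2 := abs_mul_sub_mul_le (c := ‖x‖ ^ 4) (q := ‖x‖ ^ 4) (by positivity) le_rfl m04
    have herr' := herr.trans e0
    rw [abs_le] at *
    constructor <;> linarith [e1.1, e1.2, e2.1, e2.2, herr'.1, herr'.2]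
  · obtain ⟨v, hv, hzv, hX, hρ, ht, m40, -, m22, -, -⟩ := hsetup z hz
    have hζ := norm_pos_iff.2 hz
    rw [hessianForm_weightedLoss _ _ _ _ hH.differentiable hH.differentiable_deriv hz,
      half_inv_mul_sum]
    simp only [hzv, hx_inner, real_inner_self_eq_norm_sq, termDeriv₂_radial hζ.ne']
    rw [empMean_sub, empMean_const_mul, empMean_const_mul, hX]
    change |1 / 2 * (12 * ‖z‖ ^ 4 * weightedMoment H r (fun k => inner ℝ (a k) v)
      (fun k => inner ℝ (a k) u) 4 0 - 4 * ‖z‖ ^ 2 * ‖x‖ ^ 2 * weightedMoment H r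
      (fun k => inner ℝ (a k) v) (fun k => inner ℝ (a k) u) 2 2) - _| ≤ _
    have e1 := abs_mul_sub_mul_le (c := ‖z‖ ^ 4) (q := ‖x‖ ^ 4) (by positivity) (by gcongr) m40
    have e2 := abs_mul_sub_mul_le (c := ‖z‖ ^ 2 * ‖x‖ ^ 2) (q := ‖x‖ ^ 4) (by positivity)
      (by rw [show ‖x‖ ^ 4 = ‖x‖ ^ 2 * ‖x‖ ^ 2 by ring]; gcongr) m22
    rw [abs_le] at *
    constructor <;> linarith [e1.1, e1.2, e2.1, e2.2]

/-- The loss function in terms of a cutoff on the real line and the normalized signal. -/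
lemma loss_eq_weightedLoss {n m : ℕ} {h H : ℝ → ℝ} (hH : ∀ u, 0 ≤ u → h u = H u)
    (a : Fin m → EuclideanSpace ℝ (Fin n)) {x : EuclideanSpace ℝ (Fin n)} (hx : x ≠ 0) :
    loss h a x = weightedLoss H (1 / (2 * (m : ℝ))) a (fun k => inner ℝ (a k) x ^ 2)
      fun k => H (inner ℝ (a k) (‖x‖⁻¹ • x) ^ 2 /
        empMean fun j => inner ℝ (a j) (‖x‖⁻¹ • x) ^ 2) := by
  have hξ : ‖x‖ ≠ 0 := norm_ne_zero_iff.2 hx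
  ext z
  rw [loss, weightedLoss]
  congr 1
  refine Finset.sum_congr rfl fun k _ => ?_
  have hm : (m : ℝ) ≠ 0 := by exact_mod_cast (Fin.pos k).ne'
  -- The quotient is homogeneous of degree 0 in `x`, so `x` may be normalized.
  have h1 : (m : ℝ) * |inner ℝ (a k) x| ^ 2 / ∑ j : Fin m, |measurement a x j| =
      inner ℝ (a k) (‖x‖⁻¹ • x) ^ 2 / empMean fun j => inner ℝ (a j) (‖x‖⁻¹ • x) ^ 2 := by
    simp only [measurement, sq_abs, abs_sq, real_inner_smul_right, mul_pow, empMean,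
      ← Finset.mul_sum]
    rw [mul_left_comm, mul_div_mul_left _ _ (pow_ne_zero 2 (inv_ne_zero hξ)), one_div,
      div_mul_eq_div_div, div_inv_eq_mul, mul_comm]
  rw [h1, sq_abs, hH _ (by positivity), hH _ (div_nonneg (sq_nonneg _)
    (empMean_nonneg fun j => sq_nonneg _))]

/-- Since `R⁻¹² = 64 β⁻⁶` and `D` is linear in `β`, the errors are of order `β⁻¹`, `β²·β⁻⁶` and
`β⁴·β⁻⁶`, hence all `O(1/β)`; `128 = 2·64` and `6656 = 104·64`. -/
lemma truncation_error_le {δ κ M K A β R D : ℝ} (hδ : 0 < δ) (hA : 0 < A)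
    (hβ1 : 1 ≤ β) (hR : R ^ 2 = β / 2) (hD : D = κ * β * K)
    (hβ : 1000 * (2 * A + 128 * A * κ ^ 2 * K ^ 2 + 6656 * |M| * κ ^ 4 * K ^ 4 * A) / δ ≤ β) :
    A / R ^ 2 + D ^ 2 * (A / R ^ 12 + A / R ^ 12) ≤ δ / 1000 ∧
      104 * M * D ^ 4 * (A / R ^ 12) ≤ δ / 1000 := by
  have hβ0 : 0 < β := by linarith
  have hR12 : R ^ 12 = β ^ 6 / 64 := by
    rw [show R ^ 12 = (R ^ 2) ^ 6 by ring, hR]; ring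
  rw [div_le_iff₀ hδ] at hβ
  have e1 : A / R ^ 2 + D ^ 2 * (A / R ^ 12 + A / R ^ 12) =
      (2 * A + 128 * A * κ ^ 2 * K ^ 2 / β ^ 3) / β := by
    rw [hR12, hR, hD]; field_simp; ring
  have e2 : 104 * M * D ^ 4 * (A / R ^ 12) = (6656 * M * κ ^ 4 * K ^ 4 * A / β) / β := by
    rw [hR12, hD]; field_simp; ring
  have b1 : 128 * A * κ ^ 2 * K ^ 2 / β ^ 3 ≤ 128 * A * κ ^ 2 * K ^ 2 :=
    div_le_self (by positivity) (one_le_pow₀ hβ1)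
  have b2 : 6656 * M * κ ^ 4 * K ^ 4 * A / β ≤ 6656 * |M| * κ ^ 4 * K ^ 4 * A := by
    refine le_trans ?_ (div_le_self (by positivity) hβ1)
    gcongr
    exact le_abs_self M
  have p1 : 0 ≤ 128 * A * κ ^ 2 * K ^ 2 := by positivity
  have p2 : 0 ≤ 6656 * |M| * κ ^ 4 * K ^ 4 * A := by positivity
  rw [e1, e2, div_le_iff₀ hβ0, div_le_iff₀ hβ0]
  constructor <;> linarith

theorem theorem3 (δ : ℝ) (hδ : 0 < δ) (hδ' : δ ≤ 1 / 100) (κ : ℝ) (hκ : 1 < κ) (M : ℝ) :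
    ∃ β₀ : ℝ, 1 < β₀ ∧ ∀ β : ℝ, β₀ ≤ β →
      ∃ C c : ℝ, 0 < C ∧ 0 < c ∧
        ∀ (h : ℝ → ℝ), IsActivation h β (κ * β) M →
        ∀ (n m : ℕ), C * (n : ℝ) ≤ (m : ℝ) →
        ∀ (x : EuclideanSpace ℝ (Fin n)), x ≠ 0 →
        ∀ (Ω : Type*) [MeasurableSpace Ω] (P : Measure Ω) [IsProbabilityMeasure P]
          (a : Fin m → Ω → EuclideanSpace ℝ (Fin n)),
          (∀ k, HasLaw (a k) (stdGaussian (EuclideanSpace ℝ (Fin n))) P) →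
          iIndepFun a P →
          P {ω | ¬ (
              (∀ z ∈ regionTwoA δ x, gradient (loss h (fun k => a k ω) x) z = 0 →
                z ∈ subregionTwoA δ x) ∧
              (∀ z ∈ subregionTwoA δ x,
                hessianForm (loss h (fun k => a k ω) x) z x ≤ -3 * ‖x‖ ^ 4 ∧
                ‖x‖ ^ 4 ≤ hessianForm (loss h (fun k => a k ω) x) z z) ∧
              (∀ z ∈ regionTwoA δ x, gradient (loss h (fun k => a k ω) x) z = 0 →
                IsRidableSaddle (loss h (fun k => a k ω) x) z))}
            ≤ ENNReal.ofReal (Real.exp (-(c * (m : ℝ)))) := by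
  obtain ⟨K, A, hK, hA, hgood⟩ := exists_highProb_truncated_moments
  set c₀ := 1000 * (2 * A + 128 * A * κ ^ 2 * K ^ 2 + 6656 * |M| * κ ^ 4 * K ^ 4 * A) / δ with hc₀
  -- The value 18 makes `R = √(β / 2)` at least 3.
  refine ⟨max 18 c₀, lt_of_lt_of_le (by norm_num) (le_max_left _ _), fun β hβ => ?_⟩
  have hβ18 : 18 ≤ β := (le_max_left _ _).trans hβ
  have hβc : c₀ ≤ β := (le_max_right _ _).trans hβ
  have hR2 : √(β / 2) ^ 2 = β / 2 := Real.sq_sqrt (by linarith)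
  have hR3 : 3 ≤ √(β / 2) := Real.le_sqrt_of_sq_le (by linarith)
  obtain ⟨C, c, hC, hc, hprob⟩ := hgood _ hR3
  refine ⟨C, c, hC, hc, fun h hh n m hm x hx Ω _ P _ a hlaw hindep => ?_⟩
  have hu : ‖(‖x‖⁻¹ • x)‖ = 1 := by
    rw [norm_smul, norm_inv, norm_norm, inv_mul_cancel₀ (norm_ne_zero_iff.2 hx)]
  have hκβ : β < κ * β := by nlinarith
  obtain ⟨H, hH, hhH⟩ := hh.exists_isCutoff (by linarith) hκβ
  obtain ⟨hη₁, hη₂⟩ := truncation_error_le (M := M) hδ hA (by linarith) hR2 rfl hβc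
  have hL := hindep.hasLaw_pi hlaw
  refine le_trans ?_ (hprob n m hm _ hu)
  -- `Measure.le_map_apply` does not require the bad set to be measurable.
  refine le_trans (measure_mono fun ω hω => ?_)
    ((Measure.le_map_apply hL.aemeasurable _).trans (le_of_eq (by rw [hL.map_eq])))
  refine fun hQ => hω ?_
  obtain ⟨hmom, htail, hr, hr'⟩ := hQ
  rw [loss_eq_weightedLoss hhH _ hx]
  refine IsNearPopulationLoss.landscape (η := δ / 1000) ?_ hx hδ hδ' le_rfl
  have hκβ0 : 0 < κ * β := by linarith
  -- As `K ≥ 1` and `r ≤ K`, the choice `D = κ β K` dominates both `γ` and `γ r`.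
  exact isNearPopulationLoss_weightedLoss (D := κ * β * K) hH (by linarith) hR2 hκβ.le
    (by nlinarith) (by nlinarith) (by gcongr) hr (by positivity) hη₁ hη₂ _ hx hmom htail
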